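/- Let $n\ge 2$ and $N\ge 1$, and let $\xi_1,\dots,\xi_N$ be independent random points distributed uniformly on the Euclidean unit sphere $S^{n-1}\subset\mathbb{R}^n$. Let $P_N=[\xi_1,\dots,\xi_N]$ be their convex hull, let $\mathcal F(P_N)$ be the set of facets of $P_N$ (faces of dimension $\dim P_N-1$), and let $\operatorname{vol}_{n-1}$ denote $(n-1)$-dimensional Euclidean volume; let $B_2^{n-1}$ be the closed unit ball of $\mathbb{R}^{n-1}$. (A maximum over an empty set of facets is read as $0$.) Then for every $t>0$ $$\mathbb{P}\Big(\max_{F\in\mathcal F(P_N)}\operatorname{vol}_{n-1}(F)\ge t\Big)\le \min\Big\{1,\ \frac{\sqrt n}{t\,(n-1)!}\Big(\frac{6n}{n-1}\Big)^{\frac{n-1}{2}}\frac{\operatorname{vol}_{n-1}(S^{n-1})}{\operatorname{vol}_{n-1}(B_2^{n-1})}\Big(1-t\,\frac{(n-1)!}{\sqrt n}\Big(\frac{n-1}{6n}\Big)^{\frac{n-1}{2}}\frac{\operatorname{vol}_{n-1}(B_2^{n-1})}{\operatorname{vol}_{n-1}(S^{n-1})}\Big)_+^{N}\Big\},$$ where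 $a_+=\max\{a,0\}$. Moreover, $\max_{F\in\mathcal F(P_N)}\operatorname{vol}_{n-1}(F)$ is integrable and $$\mathbb{E}\max_{F\in\mathcal F(P_N)}\operatorname{vol}_{n-1}(F)\le 6^{n/2}\,\frac{\sqrt{e\,n}}{(n-1)!}\,\frac{\operatorname{vol}_{n-1}(S^{n-1})}{\operatorname{vol}_{n-1}(B_2^{n-1})}\,\frac{\log N}{N}.$$ -/

import Mathlib

open MeasureTheory ProbabilityTheory Metric
open scoped Nat

/-- The uniform probability measure on the unit sphere `S^{n-1}` of Euclidean space `ℝⁿ`: the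
surface measure `volume.toSphere`, normalized to total mass one. -/
noncomputable def uniformSphere (n : ℕ) :
    Measure (sphere (0 : EuclideanSpace ℝ (Fin n)) 1) :=
  ((volume : Measure (EuclideanSpace ℝ (Fin n))).toSphere Set.univ)⁻¹ •
    (volume : Measure (EuclideanSpace ℝ (Fin n))).toSphere

/-- `vol_{n-1}(S^{n-1})`, the total surface area of the unit sphere of `ℝⁿ`. -/
noncomputable def sphereVol (n : ℕ) : ℝ :=
  (volume : Measure (EuclideanSpace ℝ (Fin n))).toSphere.real Set.univ

/-- `vol_n(B_2^n)`, the volume of the closed Euclidean unit ball of `ℝⁿ`. -/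
noncomputable def ballVol (n : ℕ) : ℝ :=
  (volume : Measure (EuclideanSpace ℝ (Fin n))).real (closedBall 0 1)

/-- The dimension of (the affine hull of) a nonempty subset of `ℝⁿ`. -/
noncomputable def affDim {n : ℕ} (s : Set (EuclideanSpace ℝ (Fin n))) : ℕ :=
  Module.finrank ℝ (affineSpan ℝ s).direction

/-- The set of facets of a polytope `P`: the nonempty faces `F` of `P` (intersections of `P` with a
supporting hyperplane) such that `dim F = dim P - 1`. -/
def facets {n : ℕ} (P : Set (EuclideanSpace ℝ (Fin n))) :
    Set (Set (EuclideanSpace ℝ (Fin n))) :=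
  {F | F.Nonempty ∧ IsExposed ℝ P F ∧ affDim F + 1 = affDim P}

/-- The maximum of `vol_{n-1}(F)` over the facets `F` of a polytope `P` in `ℝⁿ`, where `vol_{n-1}`
is the `(n-1)`-dimensional Hausdorff measure normalized to agree with Lebesgue measure on
hyperplanes. A polytope has finitely many facets, so that the supremum is attained if there is a
facet; it is `0` if there is none. -/
noncomputable def maxFacetVol {n : ℕ} (P : Set (EuclideanSpace ℝ (Fin n))) : ℝ :=
  sSup ((fun F => (Measure.euclideanHausdorffMeasure (n - 1)).real F) '' facets P)

/-- The convex hull `[x_1, …, x_N]` of `N` points of the unit sphere of `ℝⁿ`. -/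
def spherePolytope {n N : ℕ} (x : Fin N → sphere (0 : EuclideanSpace ℝ (Fin n)) 1) :
    Set (EuclideanSpace ℝ (Fin n)) :=
  convexHull ℝ (Set.range fun i => (x i : EuclideanSpace ℝ (Fin n)))

/-!
If a facet `F` of the polytope lies in the hyperplane `⟪u, y⟫ = h`, with outer unit normal `u`, then
all the points `ξ j` are at distance at least `ρ = √(1 - h²)` from `u`, because
`‖ξ j - u‖² ≥ 2 - 2h ≥ 1 - h²`. Almost surely any `n + 1` of the points are affinely independent, so
that `F` is a simplex inscribed in a sphere of radius `ρ` of an `(n - 1)`-dimensional space. By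
Hadamard's inequality its volume is at most `ρ^(n-1)` times that of the regular simplex inscribed in
the unit sphere (`simplexVol_le`). A facet of volume at least `t` therefore forces a ball of radius
`r` centred on the sphere to be empty, where `r^(n-1)` is proportional to `t`.

The probability of such an empty ball is bounded by averaging over its centre
(`mul_pi_exists_empty_ball_le`): around every point `y` in the ball of radius `r / 2` about `u`, the
ball of radius `r / 2` is empty too. If every cap of chordal radius `r / 2` has measure at least
`a`, the expected measure of the set of such `y` is at most `(1 - a)^N`, and Markov's inequality
gives the bound `(1 - a)^N / a`. The cap is compared with the cone over its base (`le_uniformSphere_ball`),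
which is where the constant `6` arises. The bound on the expectation is the integral of the tail
bound, split at `a = log N / N` (`integral_le_of_tail_le`).

For measurability, the maximal facet volume is almost surely equal to a maximum of finitely many
functions of the points, each a square root of a Gram determinant restricted to a closed set
(`GeneralPosition.maxFacetVol_eq`). The hull of at most `n` points has no facet of
dimension `n - 1`.
-/

section

open scoped Pointwise

/-! ### Volumes of simplices -/

/-- The volume of the corner simplex `{x ≥ 0, ∑ xᵢ ≤ r}` of `ℝᵐ`. -/
lemma volume_cornerSimplex (m : ℕ) : ∀ {r : ℝ}, 0 ≤ r →
    volume {x : Fin m → ℝ | (∀ i, 0 ≤ x i) ∧ ∑ i, x i ≤ r} = ENNReal.ofReal (r ^ m / m !) := by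
  induction m with
  | zero =>
    intro r hr
    have : {x : Fin 0 → ℝ | (∀ i, 0 ≤ x i) ∧ ∑ i, x i ≤ r} = Set.univ := by
      ext x; simp [hr]
    rw [this]
    simp [volume_pi]
  | succ m ih =>
    intro r hr
    set T : Set (ℝ × (Fin m → ℝ)) :=
      {p | 0 ≤ p.1 ∧ (∀ i, 0 ≤ p.2 i) ∧ p.1 + ∑ i, p.2 i ≤ r} with hT
    have hTc : IsClosed T := by
      simp only [hT, Set.ofPred_and, Set.ofPred_forall]
      refine (isClosed_le (by fun_prop) (by fun_prop)).inter
        ((isClosed_iInter fun i => isClosed_le (by fun_prop) (by fun_prop)).inter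
          (isClosed_le (by fun_prop) (by fun_prop)))
    have hpre : {x : Fin (m + 1) → ℝ | (∀ i, 0 ≤ x i) ∧ ∑ i, x i ≤ r} =
        (MeasurableEquiv.piFinSuccAbove (fun _ => ℝ) 0) ⁻¹' T := by
      ext x
      simp [hT, Fin.forall_fin_succ, Fin.sum_univ_succ, Fin.tail, and_assoc]
    rw [hpre, (volume_preserving_piFinSuccAbove (fun _ : Fin (m + 1) => ℝ) 0).measure_preimage
      hTc.measurableSet.nullMeasurableSet, Measure.volume_eq_prod,
      Measure.prod_apply hTc.measurableSet]
    have hslice : ∀ t : ℝ, volume (Prod.mk t ⁻¹' T) =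
        (Set.Icc 0 r).indicator (fun t => ENNReal.ofReal ((r - t) ^ m / m !)) t := by
      intro t
      by_cases ht : t ∈ Set.Icc 0 r
      · rw [Set.indicator_of_mem ht, ← ih (sub_nonneg.2 ht.2)]
        congr 1
        ext x
        simp [hT, ht.1, le_sub_iff_add_le']
      · rw [Set.indicator_of_notMem ht]
        have : Prod.mk t ⁻¹' T = ∅ := by
          ext x
          simp only [hT, Set.mem_preimage, Set.mem_ofPred_eq, Set.mem_empty_iff_false, iff_false]
          rintro ⟨h1, h2, h3⟩
          exact ht ⟨h1, by linarith [Finset.sum_nonneg fun i (_ : i ∈ Finset.univ) => h2 i]⟩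
        simp [this]
    simp_rw [hslice]
    rw [lintegral_indicator measurableSet_Icc, ← ofReal_integral_eq_lintegral_ofReal]
    · congr 1
      rw [integral_Icc_eq_integral_Ioc, ← intervalIntegral.integral_of_le hr,
        intervalIntegral.integral_div,
        intervalIntegral.integral_comp_sub_left (fun t => t ^ m) r]
      simp [integral_pow, Nat.factorial_succ]
      field_simp
    · exact (by fun_prop : Continuous fun t : ℝ => (r - t) ^ m / m !).continuousOn.integrableOn_Icc
    · filter_upwards [ae_restrict_mem measurableSet_Icc] with t ht
      have := sub_nonneg.2 ht.2
      positivity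

/-- The volume of the convex hull of the origin and the standard basis vectors of `ℝᵐ`. -/
noncomputable def cornerVol (m : ℕ) : ℝ :=
  (volume : Measure (EuclideanSpace ℝ (Fin m))).real
    (convexHull ℝ (Set.range (Fin.cons 0 fun i => EuclideanSpace.single i 1)))

lemma cornerVol_nonneg (m : ℕ) : 0 ≤ cornerVol m := measureReal_nonneg

lemma cornerVol_le (m : ℕ) : cornerVol m ≤ 1 / m ! := by
  have hsub : convexHull ℝ (Set.range (Fin.cons 0 fun i => EuclideanSpace.single i 1)) ⊆
      (WithLp.ofLp : EuclideanSpace ℝ (Fin m) → _) ⁻¹' {x | (∀ i, 0 ≤ x i) ∧ ∑ i, x i ≤ 1} := by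
    refine convexHull_min ?_ ?_
    · rintro _ ⟨i, rfl⟩
      refine Fin.cases ?_ (fun i => ?_) i
      · simp
      · simp only [Fin.cons_succ, Set.mem_preimage, Set.mem_ofPred_eq, PiLp.ofLp_single,
          Pi.single_apply]
        refine ⟨fun j => by split_ifs <;> norm_num, by simp⟩
    · intro x hx y hy a b ha hb hab
      refine ⟨fun i => ?_, ?_⟩
      · have := hx.1 i
        have := hy.1 i
        simp only [WithLp.ofLp_add, WithLp.ofLp_smul, Pi.add_apply, Pi.smul_apply, smul_eq_mul]
        positivity
      · have h1 := hx.2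
        have h2 := hy.2
        simp only [WithLp.ofLp_add, WithLp.ofLp_smul, Pi.add_apply, Pi.smul_apply, smul_eq_mul,
          Finset.sum_add_distrib, ← Finset.mul_sum]
        nlinarith
  have hv : volume ((WithLp.ofLp : EuclideanSpace ℝ (Fin m) → _) ⁻¹'
      {x | (∀ i, 0 ≤ x i) ∧ ∑ i, x i ≤ 1}) = ENNReal.ofReal (1 / m !) := by
    have h := (EuclideanSpace.volume_preserving_symm_measurableEquiv_toLp (Fin m)
      ).measure_preimage_equiv {x | (∀ i, 0 ≤ x i) ∧ ∑ i, x i ≤ 1}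
    rw [MeasurableEquiv.coe_toLp_symm] at h
    rw [h, volume_cornerSimplex m zero_le_one, one_pow]
  have := measure_mono (μ := volume) hsub
  rw [hv] at this
  rw [cornerVol, Measure.real]
  exact ENNReal.toReal_le_of_le_ofReal (by positivity) this

/-- The matrix whose rows are the edge vectors at `w 0` of the simplex with vertices `w i`. -/
def edgeMatrix {m : ℕ} (w : Fin (m + 1) → EuclideanSpace ℝ (Fin m)) : Matrix (Fin m) (Fin m) ℝ :=
  Matrix.of fun i j => w i.succ j - w 0 j

/-- The Gram matrix of the edge vectors at `v 0` of the simplex with vertices `v i`. -/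
def edgeGram {m : ℕ} {V : Type*} [NormedAddCommGroup V] [InnerProductSpace ℝ V]
    (v : Fin (m + 1) → V) : Matrix (Fin m) (Fin m) ℝ :=
  Matrix.of fun i j => inner ℝ (v i.succ - v 0) (v j.succ - v 0)

/-- A simplex is the image of the corner simplex under an affine map, whose linear part has the edge
matrix as its transpose. -/
lemma volume_convexHull_range {m : ℕ} (w : Fin (m + 1) → EuclideanSpace ℝ (Fin m)) :
    (volume : Measure (EuclideanSpace ℝ (Fin m))).real (convexHull ℝ (Set.range w)) =
      |(edgeMatrix w).det| * cornerVol m := by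
  set L : EuclideanSpace ℝ (Fin m) →ₗ[ℝ] EuclideanSpace ℝ (Fin m) :=
    Matrix.toLpLin 2 2 (edgeMatrix w).transpose with hL
  have hLs : ∀ i, L (EuclideanSpace.single i 1) = w i.succ - w 0 := by
    intro i
    ext j
    simp [hL, Matrix.toLpLin_apply, edgeMatrix]
  have h1 : Set.range w =
      w 0 +ᵥ L '' Set.range (Fin.cons 0 fun i => EuclideanSpace.single i 1) := by
    rw [← Set.range_comp, ← Set.image_vadd, ← Set.range_comp]
    congr 1
    funext i
    refine Fin.cases ?_ (fun i => ?_) i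
    · simp
    · simp [hLs]
  rw [h1, convexHull_vadd, ← L.image_convexHull, Measure.real, measure_vadd,
    Measure.addHaar_image_linearMap, ENNReal.toReal_mul, ENNReal.toReal_ofReal (abs_nonneg _),
    cornerVol, Measure.real]
  congr 2
  rw [hL, Matrix.toLpLin_eq_toLin, LinearMap.det_toLin, Matrix.det_transpose]

lemma det_edgeMatrix_sq {m : ℕ} (w : Fin (m + 1) → EuclideanSpace ℝ (Fin m)) :
    (edgeMatrix w).det ^ 2 = (edgeGram w).det := by
  have : edgeGram w = edgeMatrix w * (edgeMatrix w).transpose := by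
    ext i j
    simp [edgeGram, edgeMatrix, Matrix.mul_apply, PiLp.inner_apply, mul_comm]
  rw [this, Matrix.det_mul, Matrix.det_transpose, sq]

/-- **Hadamard's inequality** for the rows of a real square matrix. -/
lemma abs_det_le_prod_norm_row {k : ℕ} (A : Matrix (Fin k) (Fin k) ℝ) :
    |A.det| ≤ ∏ i, ‖(WithLp.toLp 2 (A i) : EuclideanSpace ℝ (Fin k))‖ := by
  have : Fact (Module.finrank ℝ (EuclideanSpace ℝ (Fin k)) = k) := ⟨by simp⟩
  set b := EuclideanSpace.basisFun (Fin k) ℝ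
  have h := b.toBasis.orientation.abs_volumeForm_apply_le fun i => WithLp.toLp 2 (A i)
  rw [Orientation.volumeForm_robust' _ b, Module.Basis.det_apply] at h
  have hA : b.toBasis.toMatrix (fun i => WithLp.toLp 2 (A i)) = A.transpose := by
    ext i j
    simp [b, Module.Basis.toMatrix_apply]
  rwa [hA, Matrix.det_transpose] at h

/-- The determinant of the matrix with rows `(s, wᵢ)` is `s` times that of the edge matrix. -/
lemma det_cons_rows {m : ℕ} (s : ℝ) (w : Fin (m + 1) → EuclideanSpace ℝ (Fin m)) :
    (Matrix.of fun i => (Fin.cons s (w i) : Fin (m + 1) → ℝ)).det = s * (edgeMatrix w).det := by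
  set B : Matrix (Fin (m + 1)) (Fin (m + 1)) ℝ := Matrix.of
    (Fin.cons (Fin.cons s (w 0)) fun i => Fin.cons 0 fun j => w i.succ j - w 0 j) with hB
  have h1 : (Matrix.of fun i => (Fin.cons s (w i) : Fin (m + 1) → ℝ)).det = B.det := by
    refine Matrix.det_eq_of_forall_row_eq_smul_add_const (Fin.cons 0 fun _ => 1) 0 rfl ?_
    intro i j
    refine Fin.cases ?_ (fun i => ?_) i <;> refine Fin.cases ?_ (fun j => ?_) j <;> simp [hB]
  have h2 : B.submatrix Fin.succ Fin.succ = edgeMatrix w := by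
    ext i j
    simp [hB, edgeMatrix]
  rw [h1, Matrix.det_succ_column_zero, Fin.sum_univ_succ, Finset.sum_eq_zero]
  · simp only [Fin.succAbove_zero, h2]
    simp [hB]
  · intro i _
    simp [hB]

/-- Among the simplices inscribed in a sphere of radius `r`, the edge determinant is at most that of
the regular simplex. -/
lemma abs_det_edgeMatrix_le {m : ℕ} (hm : 1 ≤ m) {r : ℝ} (hr : 0 ≤ r)
    (w : Fin (m + 1) → EuclideanSpace ℝ (Fin m)) (hw : ∀ i, ‖w i‖ = r) :
    |(edgeMatrix w).det| ≤ r ^ m * (√(m + 1) * √((m + 1) / m) ^ m) := by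
  have hm0 : (0 : ℝ) < m := by exact_mod_cast hm
  rcases hr.eq_or_lt with rfl | hr
  · have h0 : edgeMatrix w = 0 := by
      ext i j
      simp [edgeMatrix, norm_eq_zero.1 (hw _)]
    have : Nonempty (Fin m) := ⟨⟨0, hm⟩⟩
    rw [h0, Matrix.det_zero, abs_zero]
    positivity
  -- appending the constant coordinate `r / √m` turns the vertices of the regular simplex into an
  -- orthogonal frame, the case of equality in Hadamard's inequality
  have h := abs_det_le_prod_norm_row
    (Matrix.of fun i => (Fin.cons (r / √m) (w i) : Fin (m + 1) → ℝ))
  have hn : ∀ i, ‖(WithLp.toLp 2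
      ((Matrix.of fun i => (Fin.cons (r / √m) (w i) : Fin (m + 1) → ℝ)) i)
      : EuclideanSpace ℝ (Fin (m + 1)))‖ = r * √((m + 1) / m) := by
    intro i
    rw [← Real.sqrt_sq (norm_nonneg _), EuclideanSpace.norm_sq_eq, Fin.sum_univ_succ]
    have h2 := EuclideanSpace.norm_sq_eq (w i)
    rw [hw i] at h2
    simp only [Matrix.of_apply, Fin.cons_zero, Fin.cons_succ]
    rw [← h2, Real.norm_eq_abs, sq_abs, div_pow, Real.sq_sqrt hm0.le,
      show r ^ 2 / m + r ^ 2 = r ^ 2 * ((m + 1) / m) by field_simp; ring,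
      Real.sqrt_mul (sq_nonneg r), Real.sqrt_sq hr.le]
  rw [Finset.prod_congr rfl fun i _ => hn i, Finset.prod_const, Finset.card_univ, Fintype.card_fin,
    det_cons_rows, abs_mul, abs_of_pos (by positivity)] at h
  have hs : √((m + 1) / m) = √(m + 1) / √m := Real.sqrt_div (by positivity) _
  have hsm : 0 < √(m : ℝ) := Real.sqrt_pos.2 hm0
  have h3 : r / √m * |(edgeMatrix w).det| ≤
      r / √m * (r ^ m * (√(m + 1) * √((m + 1) / m) ^ m)) := by
    refine h.trans_eq ?_
    rw [mul_pow, pow_succ (√((m + 1) / m)), pow_succ r]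
    nth_rewrite 2 [hs]
    field_simp
  exact le_of_mul_le_mul_left h3 (by positivity)

/-- Points of a hyperplane of `ℝᵐ⁺¹` have isometric coordinates in `ℝᵐ`, centred at the foot of the
perpendicular from the origin. -/
lemma exists_isometric_coordinates {m : ℕ} {u : EuclideanSpace ℝ (Fin (m + 1))} (hu : ‖u‖ = 1) :
    ∃ f : EuclideanSpace ℝ (Fin m) →ₗᵢ[ℝ] EuclideanSpace ℝ (Fin (m + 1)),
      (∀ y, inner ℝ u (f y) = 0) ∧ ∀ z, inner ℝ u z = 0 → ∃ y, f y = z := by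
  have : Fact (Module.finrank ℝ (EuclideanSpace ℝ (Fin (m + 1))) = m + 1) := ⟨by simp⟩
  have hu0 : u ≠ 0 := by rintro rfl; simp at hu
  set b := OrthonormalBasis.fromOrthogonalSpanSingleton (𝕜 := ℝ) m hu0
  refine ⟨(Submodule.subtypeₗᵢ _).comp b.repr.symm.toLinearIsometry, fun y => ?_, fun z hz => ?_⟩
  · exact Submodule.mem_orthogonal_singleton_iff_inner_right.1 (b.repr.symm y).2
  · exact ⟨b.repr ⟨z, Submodule.mem_orthogonal_singleton_iff_inner_right.2 hz⟩, by simp⟩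

/-- The `m`-dimensional volume of a simplex with `m + 1` vertices in a Euclidean space. -/
noncomputable def simplexVol {m : ℕ} (v : Fin (m + 1) → EuclideanSpace ℝ (Fin (m + 1))) : ℝ :=
  (Measure.euclideanHausdorffMeasure m).real (convexHull ℝ (Set.range v))

/-- Isometric coordinates for `m + 1` points of a hyperplane at height `h`, in which the volume of
the simplex is given by a determinant. -/
lemma exists_coordinates_simplexVol {m : ℕ} {u : EuclideanSpace ℝ (Fin (m + 1))} (hu : ‖u‖ = 1)
    {h : ℝ} (v : Fin (m + 1) → EuclideanSpace ℝ (Fin (m + 1))) (hv : ∀ i, inner ℝ u (v i) = h) :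
    ∃ w : Fin (m + 1) → EuclideanSpace ℝ (Fin m),
      (∀ i, ‖w i‖ ^ 2 = ‖v i‖ ^ 2 - h ^ 2) ∧ edgeGram w = edgeGram v ∧
      simplexVol v = |(edgeMatrix w).det| * cornerVol m := by
  obtain ⟨f, hf, hf'⟩ := exists_isometric_coordinates hu
  have hz : ∀ i, inner ℝ u (v i - h • u) = 0 := fun i => by
    rw [inner_sub_right, hv, inner_smul_right, real_inner_self_eq_norm_sq, hu]; ring
  choose w hw using fun i => hf' _ (hz i)
  have hvw : v = fun i => h • u + f (w i) := by funext i; rw [hw]; abel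
  refine ⟨w, fun i => ?_, ?_, ?_⟩
  · rw [← f.norm_map, hw, norm_sub_sq_real, inner_smul_right, real_inner_comm, hv, norm_smul, hu,
      Real.norm_eq_abs, mul_one, sq_abs]
    ring
  · ext i j
    simp only [edgeGram, Matrix.of_apply, hvw, add_sub_add_left_eq_sub, ← map_sub,
      f.inner_map_map]
  · have h1 : Set.range v = h • u +ᵥ f.toLinearMap '' Set.range w := by
      rw [← Set.range_comp, ← Set.image_vadd, ← Set.range_comp, hvw]
      rfl
    rw [← volume_convexHull_range, simplexVol, h1, convexHull_vadd, ← LinearMap.image_convexHull,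
      Measure.real, measure_vadd, LinearIsometry.coe_toLinearMap,
      f.isometry.euclideanHausdorffMeasure_image,
      EuclideanSpace.euclideanHausdorffMeasure_eq_volume, Measure.real]

lemma simplexVol_eq {m : ℕ} {u : EuclideanSpace ℝ (Fin (m + 1))} (hu : ‖u‖ = 1)
    {h : ℝ} (v : Fin (m + 1) → EuclideanSpace ℝ (Fin (m + 1))) (hv : ∀ i, inner ℝ u (v i) = h) :
    simplexVol v = √(edgeGram v).det * cornerVol m := by
  obtain ⟨w, -, hG, hw⟩ := exists_coordinates_simplexVol hu v hv
  rw [hw, ← hG, ← det_edgeMatrix_sq, Real.sqrt_sq_eq_abs]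

/-- The volume of the regular simplex with `m + 1` vertices inscribed in the unit sphere of
`ℝᵐ`, by its explicit formula. -/
noncomputable def regularSimplexVol (m : ℕ) : ℝ := √(m + 1) * √((m + 1) / m) ^ m / m !

lemma regularSimplexVol_pos {m : ℕ} (hm : 1 ≤ m) : 0 < regularSimplexVol m := by
  have : (0 : ℝ) < m := by exact_mod_cast hm
  rw [regularSimplexVol]
  positivity

/-- A simplex with vertices on the unit sphere, in a hyperplane at distance `|h|` from the origin,
is at most as large as the regular simplex inscribed in a sphere of radius `√(1 - h²)`. -/
lemma simplexVol_le {m : ℕ} (hm : 1 ≤ m) {u : EuclideanSpace ℝ (Fin (m + 1))} (hu : ‖u‖ = 1)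
    {h : ℝ} (v : Fin (m + 1) → EuclideanSpace ℝ (Fin (m + 1))) (hv : ∀ i, inner ℝ u (v i) = h)
    (hv1 : ∀ i, ‖v i‖ = 1) :
    simplexVol v ≤ √(1 - h ^ 2) ^ m * regularSimplexVol m := by
  obtain ⟨w, hn, -, hw⟩ := exists_coordinates_simplexVol hu v hv
  have h1 := abs_det_edgeMatrix_le hm (Real.sqrt_nonneg (1 - h ^ 2)) w fun i => by
    rw [← Real.sqrt_sq (norm_nonneg (w i)), hn, hv1, one_pow]
  rw [hw, regularSimplexVol]
  calc |(edgeMatrix w).det| * cornerVol m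
      ≤ (√(1 - h ^ 2) ^ m * (√(m + 1) * √((m + 1) / m) ^ m)) * (1 / m !) := by
        gcongr
        · exact cornerVol_nonneg m
        · exact cornerVol_le m
    _ = _ := by ring

/-! ### Facets of polytopes with vertices in general position -/

/-- The face of a polytope on which a functional attains its maximum is spanned by vertices. -/
lemma convexHull_range_inter_level {V : Type*} [AddCommGroup V] [Module ℝ V] {ι : Type*} [Fintype ι]
    (x : ι → V) (l : V →ₗ[ℝ] ℝ) {c : ℝ} (hc : ∀ j, l (x j) ≤ c) :
    {y ∈ convexHull ℝ (Set.range x) | l y = c} = convexHull ℝ (x '' {j | l (x j) = c}) := by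
  classical
  apply Set.Subset.antisymm
  · rintro y ⟨hy, hyc⟩
    rw [convexHull_range_eq_exists_affineCombination] at hy
    obtain ⟨s, w, hw0, hw1, rfl⟩ := hy
    rw [Finset.affineCombination_eq_linear_combination _ _ _ hw1] at hyc ⊢
    have h0 : ∑ i ∈ s, w i * (c - l (x i)) = 0 := by
      simp only [mul_sub, Finset.sum_sub_distrib, ← Finset.sum_mul, hw1]
      simp only [map_sum, map_smul, smul_eq_mul] at hyc
      linarith
    have h1 := (Finset.sum_eq_zero_iff_of_nonneg fun i hi =>
      mul_nonneg (hw0 i hi) (sub_nonneg.2 (hc i))).1 h0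
    have h2 : ∀ i ∈ s, i ∉ s.filter (fun i => l (x i) = c) → w i = 0 := by
      intro i hi hif
      rcases mul_eq_zero.1 (h1 i hi) with h | h
      · exact h
      · exact absurd (Finset.mem_filter.2 ⟨hi, by linarith⟩) hif
    rw [← Finset.sum_subset (Finset.filter_subset (fun i => l (x i) = c) s)
      fun i hi hif => by rw [h2 i hi hif, zero_smul]]
    refine (convex_convexHull ℝ _).sum_mem (fun i hi => hw0 i (Finset.filter_subset _ _ hi)) ?_
      fun i hi => subset_convexHull ℝ _ ⟨i, (Finset.mem_filter.1 hi).2, rfl⟩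
    rw [Finset.sum_subset (Finset.filter_subset (fun i => l (x i) = c) s) h2, hw1]
  · refine convexHull_min ?_ ?_
    · rintro _ ⟨j, hj, rfl⟩
      exact ⟨subset_convexHull ℝ _ ⟨j, rfl⟩, hj⟩
    · exact (convex_convexHull ℝ _).inter (convex_hyperplane l.isLinear c)

lemma affDim_convexHull {n : ℕ} (s : Set (EuclideanSpace ℝ (Fin n))) :
    affDim (convexHull ℝ s) = Module.finrank ℝ (vectorSpan ℝ s) := by
  rw [affDim, affineSpan_convexHull, direction_affineSpan]

/-- Points are in general position if any `m + 2` of them, with distinct indices, are affinely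
independent. -/
def GeneralPosition {m N : ℕ} (x : Fin N → EuclideanSpace ℝ (Fin (m + 1))) : Prop :=
  ∀ J : Fin (m + 2) ↪ Fin N, AffineIndependent ℝ (x ∘ J)

/-- A hyperplane contains at most `m + 1` of the points in general position. -/
lemma GeneralPosition.card_level_le {m N : ℕ} {x : Fin N → EuclideanSpace ℝ (Fin (m + 1))}
    (hx : GeneralPosition x) {u : EuclideanSpace ℝ (Fin (m + 1))} (hu : u ≠ 0) (c : ℝ) :
    Fintype.card {j // inner ℝ u (x j) = c} ≤ m + 1 := by
  by_contra! hcard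
  obtain ⟨e⟩ : Nonempty (Fin (m + 2) ↪ {j // inner ℝ u (x j) = c}) :=
    Function.Embedding.nonempty_of_card_le (by rw [Fintype.card_fin]; exact hcard)
  have htop := (hx
    (e.trans (Function.Embedding.subtype _))).vectorSpan_eq_top_of_card_eq_finrank_add_one
    (by simp)
  have hle : vectorSpan ℝ (Set.range (x ∘ (e.trans (Function.Embedding.subtype _)))) ≤
      LinearMap.ker (innerₛₗ ℝ u) := by
    rw [vectorSpan_def, Submodule.span_le]
    rintro _ ⟨_, ⟨i, rfl⟩, _, ⟨j, rfl⟩, rfl⟩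
    simp [inner_sub_right, (e i).2, (e j).2]
  rw [htop] at hle
  have : u ∈ LinearMap.ker (innerₛₗ ℝ u) := hle trivial
  simp at this
  exact hu this

/-- The vertices `x (I i)` lie in a common supporting hyperplane of the convex hull of the points
`x j`, with outer unit normal `u`. -/
def IsSupporting {m N : ℕ} (x : Fin N → EuclideanSpace ℝ (Fin (m + 1)))
    (I : Fin (m + 1) → Fin N) (u : EuclideanSpace ℝ (Fin (m + 1))) : Prop :=
  ‖u‖ = 1 ∧ ∀ i j, inner ℝ u (x j) ≤ inner ℝ u (x (I i))

lemma IsSupporting.inner_eq {m N : ℕ} {x : Fin N → EuclideanSpace ℝ (Fin (m + 1))}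
    {I : Fin (m + 1) → Fin N} {u : EuclideanSpace ℝ (Fin (m + 1))} (h : IsSupporting x I u)
    (i : Fin (m + 1)) : inner ℝ u ((x ∘ I) i) = inner ℝ u (x (I 0)) :=
  le_antisymm (h.2 _ _) (h.2 _ _)

/-- A facet of a polytope whose vertices are in general position is spanned by `m + 1` vertices
(with repetitions if it has fewer). -/
lemma exists_supporting_of_mem_facets {m N : ℕ} {x : Fin N → EuclideanSpace ℝ (Fin (m + 1))}
    (hx : GeneralPosition x) {F : Set (EuclideanSpace ℝ (Fin (m + 1)))}
    (hF : F ∈ facets (convexHull ℝ (Set.range x))) :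
    ∃ I u, IsSupporting x I u ∧ F = convexHull ℝ (Set.range (x ∘ I)) := by
  obtain ⟨hne, hexp, hdim⟩ := hF
  obtain ⟨l, hl⟩ := hexp hne
  obtain ⟨y₀, hy₀⟩ := hne
  set v := (InnerProductSpace.toDual ℝ (EuclideanSpace ℝ (Fin (m + 1)))).symm l with hv
  have hlv : ∀ y, l y = inner ℝ v y := fun y => by simp [hv]
  have hv0 : v ≠ 0 := by
    intro h0
    have : F = convexHull ℝ (Set.range x) := by
      rw [hl]; ext y; simp [hlv, h0]
    rw [this] at hdim
    omega
  have hvn : 0 < ‖v‖ := norm_pos_iff.2 hv0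
  have hy₀' := hl ▸ hy₀
  have hle : ∀ j, l (x j) ≤ l y₀ := fun j => hy₀'.2 _ (subset_convexHull ℝ _ ⟨j, rfl⟩)
  have hFc : F = convexHull ℝ (x '' {j | inner ℝ v (x j) = l y₀}) := by
    have h := convexHull_range_inter_level x (innerₛₗ ℝ v) (c := l y₀)
      fun j => by simpa [← hlv] using hle j
    simp only [innerₛₗ_apply_apply] at h
    rw [← h, hl]
    ext y
    constructor
    · rintro ⟨h1, h2⟩
      exact ⟨h1, by rw [← hlv]; exact le_antisymm (hy₀'.2 _ h1) (h2 _ hy₀'.1)⟩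
    · rintro ⟨h1, h2⟩
      exact ⟨h1, fun z hz => by rw [hlv y, h2]; exact hy₀'.2 z hz⟩
  have hJ : Nonempty {j // inner ℝ v (x j) = l y₀} := by
    have : (convexHull ℝ (x '' {j | inner ℝ v (x j) = l y₀})).Nonempty := hFc ▸ ⟨y₀, hy₀⟩
    obtain ⟨_, j, hj, -⟩ := convexHull_nonempty_iff.1 this
    exact ⟨⟨j, hj⟩⟩
  obtain ⟨g⟩ : Nonempty ({j // inner ℝ v (x j) = l y₀} ↪ Fin (m + 1)) :=
    Function.Embedding.nonempty_of_card_le (by simpa using hx.card_level_le hv0 (l y₀))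
  have hsurj := Function.invFun_surjective g.injective
  set I : Fin (m + 1) → Fin N := fun i => (Function.invFun g i).1 with hI
  refine ⟨I, ‖v‖⁻¹ • v, ⟨by rw [norm_smul, norm_inv, norm_norm, inv_mul_cancel₀ hvn.ne'],
    fun i j => ?_⟩, ?_⟩
  · rw [real_inner_smul_left, real_inner_smul_left, (Function.invFun g i).2, ← hlv]
    gcongr
    exact hle j
  · rw [hFc]
    congr 1
    ext y
    constructor
    · rintro ⟨j, hj, rfl⟩
      obtain ⟨i, hi⟩ := hsurj ⟨j, hj⟩
      exact ⟨i, by simp [hI, hi]⟩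
    · rintro ⟨i, rfl⟩
      exact ⟨I i, (Function.invFun g i).2, rfl⟩

/-- Affinely independent vertices in a supporting hyperplane span a facet: by general position the
hyperplane contains no further vertex. -/
lemma GeneralPosition.mem_facets {m N : ℕ} {x : Fin N → EuclideanSpace ℝ (Fin (m + 1))}
    (hx : GeneralPosition x) (hN : m + 2 ≤ N) {I : Fin (m + 1) → Fin N}
    {u : EuclideanSpace ℝ (Fin (m + 1))} (h : IsSupporting x I u)
    (hI : AffineIndependent ℝ (x ∘ I)) :
    convexHull ℝ (Set.range (x ∘ I)) ∈ facets (convexHull ℝ (Set.range x)) := by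
  have hu0 : u ≠ 0 := by rintro rfl; simpa using h.1
  set c := inner ℝ u (x (I 0)) with hc
  have hinj : Function.Injective I := hI.injective.of_comp
  have hrange : Set.range (x ∘ I) = x '' {j | inner ℝ u (x j) = c} := by
    rw [Set.range_comp]
    congr 1
    let f : Fin (m + 1) → {j // inner ℝ u (x j) = c} := fun i => ⟨I i, h.inner_eq i⟩
    have hf : Function.Injective f := fun i j hij => hinj (Subtype.ext_iff.1 hij)
    have hb : Function.Bijective f := (Fintype.bijective_iff_injective_and_card f).2
      ⟨hf, le_antisymm (Fintype.card_le_of_injective f hf) (by simpa using hx.card_level_le hu0 c)⟩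
    ext j
    constructor
    · rintro ⟨i, rfl⟩
      exact h.inner_eq i
    · intro hj
      obtain ⟨i, hi⟩ := hb.2 ⟨j, hj⟩
      exact ⟨i, Subtype.ext_iff.1 hi⟩
  have hface := convexHull_range_inter_level x (innerₛₗ ℝ u) (c := c) fun j => h.2 0 j
  simp only [innerₛₗ_apply_apply] at hface
  have hmax : ∀ y ∈ convexHull ℝ (Set.range x), inner ℝ u y ≤ c := by
    refine convexHull_min ?_ (convex_halfSpace_le (innerₛₗ ℝ u).isLinear c)
    rintro _ ⟨j, rfl⟩
    exact h.2 0 j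
  have h0 : x (I 0) ∈ convexHull ℝ (Set.range x) := subset_convexHull ℝ _ ⟨_, rfl⟩
  refine ⟨(Set.range_nonempty _).convexHull, fun _ => ⟨innerSL ℝ u, ?_⟩, ?_⟩
  · rw [hrange, ← hface]
    ext y
    constructor
    · rintro ⟨h1, h2⟩
      exact ⟨h1, fun z hz => by simpa [h2] using hmax z hz⟩
    · rintro ⟨h1, h2⟩
      exact ⟨h1, le_antisymm (hmax y h1) (by simpa using h2 _ h0)⟩
  · rw [affDim_convexHull, affDim_convexHull, hI.finrank_vectorSpan (n := m) (by simp)]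
    have htop := (hx (Fin.castLEEmb hN)).vectorSpan_eq_top_of_card_eq_finrank_add_one (by simp)
    have : vectorSpan ℝ (Set.range x) = ⊤ :=
      top_le_iff.1 (htop ▸ vectorSpan_mono ℝ (Set.range_comp_subset_range _ _))
    rw [this]
    simp

lemma det_edgeGram_eq_zero {m : ℕ} {V : Type*} [NormedAddCommGroup V] [InnerProductSpace ℝ V]
    (v : Fin (m + 1) → V) (hv : ¬ AffineIndependent ℝ v) : (edgeGram v).det = 0 := by
  have hlin : ¬ LinearIndependent ℝ fun i : Fin m => v i.succ - v 0 := by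
    intro h
    refine hv ((affineIndependent_iff_linearIndependent_vsub ℝ v 0).2 ?_)
    rw [← linearIndependent_equiv (finSuccAboveEquiv (0 : Fin (m + 1)))]
    exact h
  obtain ⟨c, hc, i, hi⟩ := Fintype.not_linearIndependent_iff.1 hlin
  refine Matrix.exists_mulVec_eq_zero_iff.1 ⟨c, fun h => hi (by rw [h]; rfl), ?_⟩
  ext k
  have : inner ℝ (v k.succ - v 0) (∑ i, c i • (v i.succ - v 0)) = (0 : ℝ) := by
    rw [hc, inner_zero_right]
  simpa [Matrix.mulVec, dotProduct, edgeGram, inner_sum, real_inner_smul_right, mul_comm] using this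

/-- The volume of the simplex with vertices `x (I i)` if these lie in a supporting hyperplane of
the convex hull of all the points `x j`, and `0` otherwise. It is written with the Gram determinant,
to make it visibly a measurable function of `x`. -/
noncomputable def supportingVol {m N : ℕ} (I : Fin (m + 1) → Fin N)
    (x : Fin N → EuclideanSpace ℝ (Fin (m + 1))) : ℝ :=
  {x | ∃ u, IsSupporting x I u}.indicator (fun x => √(edgeGram (x ∘ I)).det * cornerVol m) x

lemma supportingVol_nonneg {m N : ℕ} (I : Fin (m + 1) → Fin N)
    (x : Fin N → EuclideanSpace ℝ (Fin (m + 1))) : 0 ≤ supportingVol I x :=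
  Set.indicator_nonneg (fun _ _ => mul_nonneg (Real.sqrt_nonneg _) (cornerVol_nonneg m)) _

lemma IsSupporting.supportingVol_eq {m N : ℕ} {x : Fin N → EuclideanSpace ℝ (Fin (m + 1))}
    {I : Fin (m + 1) → Fin N} {u : EuclideanSpace ℝ (Fin (m + 1))} (h : IsSupporting x I u) :
    supportingVol I x = simplexVol (x ∘ I) := by
  rw [supportingVol, Set.indicator_of_mem (show x ∈ {x | ∃ u, IsSupporting x I u} from ⟨u, h⟩),
    simplexVol_eq h.1 _ h.inner_eq]

/-- In general position the largest facet volume is a maximum over finitely many explicit functions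
of the vertices. -/
lemma GeneralPosition.maxFacetVol_eq {m N : ℕ} {x : Fin N → EuclideanSpace ℝ (Fin (m + 1))}
    (hx : GeneralPosition x) (hN : m + 2 ≤ N) :
    maxFacetVol (convexHull ℝ (Set.range x)) = ⨆ I : Fin (m + 1) → Fin N, supportingVol I x := by
  have hle : ∀ y ∈ (fun F => (Measure.euclideanHausdorffMeasure m).real F) ''
      facets (convexHull ℝ (Set.range x)), y ≤ ⨆ I : Fin (m + 1) → Fin N, supportingVol I x := by
    rintro _ ⟨F, hF, rfl⟩
    obtain ⟨I, u, h, rfl⟩ := exists_supporting_of_mem_facets hx hF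
    exact h.supportingVol_eq.symm.trans_le
      (le_ciSup (f := fun I => supportingVol I x) (Set.finite_range _).bddAbove I)
  apply le_antisymm
  · exact Real.sSup_le hle (Real.iSup_nonneg fun I => supportingVol_nonneg I x)
  · have h0 : 0 ≤ maxFacetVol (convexHull ℝ (Set.range x)) := by
      refine Real.sSup_nonneg ?_
      rintro _ ⟨F, -, rfl⟩
      exact measureReal_nonneg
    refine Real.iSup_le (fun I => ?_) h0
    by_cases hI : AffineIndependent ℝ (x ∘ I)
    · by_cases h : ∃ u, IsSupporting x I u
      · obtain ⟨u, h⟩ := h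
        rw [h.supportingVol_eq]
        exact le_csSup ⟨_, hle⟩ ⟨_, hx.mem_facets hN h hI, rfl⟩
      · rw [supportingVol, Set.indicator_of_notMem (show x ∉ {x | ∃ u, IsSupporting x I u} from h)]
        exact h0
    · classical
      rw [supportingVol, Set.indicator_apply, det_edgeGram_eq_zero _ hI]
      simpa using h0

/-- The convex hull of at most `m + 1` points of `ℝᵐ⁺¹` has facets of dimension less than `m`. -/
lemma maxFacetVol_eq_zero {m N : ℕ} (hN : N ≤ m + 1) (x : Fin N → EuclideanSpace ℝ (Fin (m + 1))) :
    maxFacetVol (convexHull ℝ (Set.range x)) = 0 := by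
  have hx : GeneralPosition x := fun J => by
    have := Fintype.card_le_of_embedding J
    simp at this
    omega
  refine le_antisymm (Real.sSup_nonpos ?_) (Real.sSup_nonneg ?_)
  · rintro _ ⟨F, hF, rfl⟩
    obtain ⟨I, u, h, rfl⟩ := exists_supporting_of_mem_facets hx hF
    have hI : ¬ AffineIndependent ℝ (x ∘ I) := by
      intro hI
      have h1 := hF.2.2
      rw [affDim_convexHull, affDim_convexHull, hI.finrank_vectorSpan (n := m) (by simp)] at h1
      rcases N with - | N
      · exact (I 0).elim0
      · have := finrank_vectorSpan_range_le ℝ x (n := N) (by simp)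
        omega
    have : simplexVol (x ∘ I) = 0 := by
      rw [simplexVol_eq h.1 _ h.inner_eq, det_edgeGram_eq_zero _ hI]
      simp
    exact this.le
  · rintro _ ⟨F, -, rfl⟩
    exact measureReal_nonneg

/-! ### Hyperplane sections and caps of the sphere -/

/-- Volume-preserving coordinates `(t, y)` on `ℝᵐ⁺¹`, where `t` is the component along the unit
vector `u`. -/
lemma exists_measurePreserving_coordinates {m : ℕ} {u : EuclideanSpace ℝ (Fin (m + 1))}
    (hu : ‖u‖ = 1) :
    ∃ Ψ : ℝ × EuclideanSpace ℝ (Fin m) → EuclideanSpace ℝ (Fin (m + 1)),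
      MeasurePreserving Ψ volume volume ∧ (∀ p, inner ℝ u (Ψ p) = p.1) ∧
      ∀ p, ‖Ψ p‖ ^ 2 = p.1 ^ 2 + ‖p.2‖ ^ 2 := by
  obtain ⟨f, hf, -⟩ := exists_isometric_coordinates hu
  let L : WithLp 2 (ℝ × EuclideanSpace ℝ (Fin m)) →ₗ[ℝ] EuclideanSpace ℝ (Fin (m + 1)) :=
    { toFun := fun p => p.fst • u + f p.snd
      map_add' := fun p q => by simp [add_smul]; abel
      map_smul' := fun c p => by simp [mul_smul] }
  have hsq : ∀ (t : ℝ) y, ‖t • u + f y‖ ^ 2 = t ^ 2 + ‖y‖ ^ 2 := fun t y => by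
    rw [norm_add_sq_real, real_inner_smul_left, hf, norm_smul, hu, f.norm_map]
    simp
  have hL : ∀ p, ‖L p‖ = ‖p‖ := fun p => by
    rw [← Real.sqrt_sq (norm_nonneg (L p)), WithLp.prod_norm_eq_of_L2]
    congr 1
    exact (hsq _ _).trans (by simp)
  let Li : WithLp 2 (ℝ × EuclideanSpace ℝ (Fin m)) →ₗᵢ[ℝ] EuclideanSpace ℝ (Fin (m + 1)) := ⟨L, hL⟩
  let e := Li.toLinearIsometryEquiv (by
    rw [LinearEquiv.finrank_eq (WithLp.linearEquiv 2 ℝ (ℝ × EuclideanSpace ℝ (Fin m)))]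
    simp [add_comm])
  refine ⟨fun p => p.1 • u + f p.2,
    e.measurePreserving.comp (WithLp.volume_preserving_toLp ℝ (EuclideanSpace ℝ (Fin m))),
    fun p => ?_, fun p => hsq _ _⟩
  rw [inner_add_right, inner_smul_right, hf, real_inner_self_eq_norm_sq, hu]
  ring

lemma toSphere_univ_ne_zero (m : ℕ) :
    (volume : Measure (EuclideanSpace ℝ (Fin (m + 1)))).toSphere Set.univ ≠ 0 :=
  mt Measure.measure_univ_eq_zero.1 (Measure.toSphere_ne_zero _)

lemma sphereVol_pos (m : ℕ) : 0 < sphereVol (m + 1) := by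
  rw [sphereVol, Measure.real]
  exact ENNReal.toReal_pos (toSphere_univ_ne_zero m) (measure_ne_top _ _)

lemma ballVol_pos (m : ℕ) : 0 < ballVol m :=
  ENNReal.toReal_pos (measure_closedBall_pos _ _ one_pos).ne' measure_closedBall_lt_top.ne

instance isProbabilityMeasure_uniformSphere (m : ℕ) :
    IsProbabilityMeasure (uniformSphere (m + 1)) := by
  constructor
  rw [uniformSphere, Measure.smul_apply, smul_eq_mul]
  exact ENNReal.inv_mul_cancel (toSphere_univ_ne_zero m) (measure_ne_top _ _)

lemma uniformSphere_real_apply {n : ℕ} (A : Set (sphere (0 : EuclideanSpace ℝ (Fin n)) 1)) :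
    (uniformSphere n).real A =
      (volume : Measure (EuclideanSpace ℝ (Fin n))).toSphere.real A / sphereVol n := by
  rw [uniformSphere, sphereVol, Measure.real, Measure.smul_apply, smul_eq_mul, ENNReal.toReal_mul,
    ENNReal.toReal_inv, div_eq_inv_mul]
  rfl

/-- An affine hyperplane meets the sphere in a null set: the cone over the section lies in
`{y | ⟪u, y⟫ = c ‖y‖}`. -/
lemma uniformSphere_hyperplane {m : ℕ} (hm : 1 ≤ m) {u : EuclideanSpace ℝ (Fin (m + 1))}
    (hu : ‖u‖ = 1) (c : ℝ) :
    uniformSphere (m + 1) {x | inner ℝ u (x : EuclideanSpace ℝ (Fin (m + 1))) = c} = 0 := by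
  have : Nonempty (Fin m) := ⟨⟨0, hm⟩⟩
  obtain ⟨Ψ, hΨ, hΨ1, hΨ2⟩ := exists_measurePreserving_coordinates hu
  set K : Set (EuclideanSpace ℝ (Fin (m + 1))) := {y | inner ℝ u y = c * ‖y‖} with hK
  have hKm : MeasurableSet K := (isClosed_eq (by fun_prop) (by fun_prop)).measurableSet
  have hK0 : volume K = 0 := by
    rw [← hΨ.measure_preimage hKm.nullMeasurableSet, Measure.volume_eq_prod,
      Measure.measure_prod_null (hΨ.measurable hKm)]
    have h0 : ∀ᵐ t : ℝ, t ≠ 0 := by simp [ae_iff]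
    filter_upwards [h0] with t ht
    -- the slice at height `t ≠ 0` lies in a sphere
    refine measure_mono_null (t := sphere 0 √(t ^ 2 / c ^ 2 - t ^ 2)) ?_
      (Measure.addHaar_sphere _ _ _)
    intro y hy
    have hy' : t = c * ‖Ψ (t, y)‖ := by simpa [hK, hΨ1] using hy
    have hc : c ≠ 0 := by rintro rfl; simp at hy'; exact ht hy'
    have h2 : t ^ 2 = c ^ 2 * (t ^ 2 + ‖y‖ ^ 2) := by
      have h3 := hΨ2 (t, y)
      simp only at h3
      rw [← h3, ← mul_pow, ← hy']
    rw [mem_sphere_zero_iff_norm, ← Real.sqrt_sq (norm_nonneg y)]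
    congr 1
    field_simp
    linarith
  have hA : MeasurableSet {x : sphere (0 : EuclideanSpace ℝ (Fin (m + 1))) 1 |
      inner ℝ u (x : EuclideanSpace ℝ (Fin (m + 1))) = c} :=
    (isClosed_eq (by fun_prop) (by fun_prop)).measurableSet
  rw [uniformSphere, Measure.smul_apply, Measure.toSphere_apply' _ hA,
    measure_mono_null (t := K) ?_ hK0]
  · simp
  · rintro _ ⟨r, hr, _, ⟨x, hx, rfl⟩, rfl⟩
    have hx' : inner ℝ u (x : EuclideanSpace ℝ (Fin (m + 1))) = c := hx
    have hxn : ‖(x : EuclideanSpace ℝ (Fin (m + 1)))‖ = 1 := norm_eq_of_mem_sphere x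
    show inner ℝ u (r • (x : EuclideanSpace ℝ (Fin (m + 1)))) =
      c * ‖r • (x : EuclideanSpace ℝ (Fin (m + 1)))‖
    rw [real_inner_smul_right, hx', norm_smul, hxn, Real.norm_eq_abs, abs_of_pos hr.1]
    ring

/-- The volume of the cone about the axis `u` whose base is an `m`-dimensional ball of radius
`a * h` at height `h`. -/
lemma volume_flatCone {m : ℕ} {u : EuclideanSpace ℝ (Fin (m + 1))} (hu : ‖u‖ = 1) {a h : ℝ}
    (ha : 0 < a) (hh : 0 ≤ h) :
    volume {z : EuclideanSpace ℝ (Fin (m + 1)) | inner ℝ u z ∈ Set.Ioo 0 h ∧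
      ‖z‖ ^ 2 < (1 + a ^ 2) * inner ℝ u z ^ 2} =
      ENNReal.ofReal (a ^ m * (h ^ (m + 1) / (m + 1)) * ballVol m) := by
  obtain ⟨Ψ, hΨ, hΨ1, hΨ2⟩ := exists_measurePreserving_coordinates hu
  set K : Set (EuclideanSpace ℝ (Fin (m + 1))) := {z | inner ℝ u z ∈ Set.Ioo 0 h ∧
      ‖z‖ ^ 2 < (1 + a ^ 2) * inner ℝ u z ^ 2} with hK
  have hKm : MeasurableSet K :=
    ((isOpen_Ioo.preimage (f := fun z : EuclideanSpace ℝ (Fin (m + 1)) => inner ℝ u z)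
      (by fun_prop)).inter
      (isOpen_lt (f := fun z : EuclideanSpace ℝ (Fin (m + 1)) => ‖z‖ ^ 2)
        (g := fun z => (1 + a ^ 2) * inner ℝ u z ^ 2) (by fun_prop) (by fun_prop))).measurableSet
  have hslice : ∀ t : ℝ, volume (Prod.mk t ⁻¹' (Ψ ⁻¹' K)) =
      (Set.Ioo 0 h).indicator (fun t => ENNReal.ofReal ((a * t) ^ m * ballVol m)) t := by
    intro t
    by_cases ht : t ∈ Set.Ioo 0 h
    · rw [Set.indicator_of_mem ht]
      have : Prod.mk t ⁻¹' (Ψ ⁻¹' K) = ball 0 (a * t) := by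
        ext y
        have h3 := hΨ2 (t, y)
        simp only at h3
        have hat : 0 < a * t := mul_pos ha ht.1
        simp only [hK, Set.mem_preimage, Set.mem_ofPred_eq, hΨ1, ht, true_and, h3,
          mem_ball_zero_iff]
        rw [← sq_lt_sq₀ (norm_nonneg _) hat.le]
        constructor <;> intro _ <;> linarith
      rw [this, Measure.addHaar_ball_of_pos _ _ (mul_pos ha ht.1), finrank_euclideanSpace_fin,
        ENNReal.ofReal_mul (by have := ht.1; positivity), ballVol, Measure.real,
        ENNReal.ofReal_toReal measure_closedBall_lt_top.ne,
        Measure.addHaar_unitClosedBall_eq_addHaar_unitBall]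
    · rw [Set.indicator_of_notMem ht]
      have : Prod.mk t ⁻¹' (Ψ ⁻¹' K) = ∅ := by
        ext y
        simp [hK, hΨ1, -Set.mem_Ioo, ht]
      rw [this, measure_empty]
  rw [← hΨ.measure_preimage hKm.nullMeasurableSet, Measure.volume_eq_prod,
    Measure.prod_apply (hΨ.measurable hKm)]
  simp_rw [hslice]
  rw [lintegral_indicator measurableSet_Ioo, ← ofReal_integral_eq_lintegral_ofReal]
  · congr 1
    rw [← integral_Ioc_eq_integral_Ioo, ← intervalIntegral.integral_of_le hh,
      intervalIntegral.integral_mul_const]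
    simp [mul_pow, integral_pow]
  · exact (by fun_prop : Continuous fun t : ℝ => (a * t) ^ m * ballVol m
      ).continuousOn.integrableOn_Icc.mono_set Set.Ioo_subset_Icc_self
  · filter_upwards [ae_restrict_mem measurableSet_Ioo] with t ht
    have := ht.1
    have := ballVol_pos m
    positivity

/-- The area of a spherical cap is at least the area of its base, times its distance from the
origin: the sector over the cap contains the cone over the base. -/
lemma le_toSphere_ball {m : ℕ} (x : sphere (0 : EuclideanSpace ℝ (Fin (m + 1))) 1) {s h k : ℝ}
    (hs : 0 ≤ s) (hh : 0 < h) (hk : 0 < k) (hhk : h ^ 2 + k ^ 2 = 1) (hsh : s ^ 2 = 2 - 2 * h) :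
    k ^ m * h * ballVol m ≤
      (volume : Measure (EuclideanSpace ℝ (Fin (m + 1)))).toSphere.real (ball x s) := by
  have hx : ‖(x : EuclideanSpace ℝ (Fin (m + 1)))‖ = 1 := norm_eq_of_mem_sphere x
  have hb := ballVol_pos m
  have hsub : {z : EuclideanSpace ℝ (Fin (m + 1)) |
      inner ℝ (x : EuclideanSpace ℝ (Fin (m + 1))) z ∈ Set.Ioo 0 h ∧
      ‖z‖ ^ 2 < (1 + (k / h) ^ 2) * inner ℝ (x : EuclideanSpace ℝ (Fin (m + 1))) z ^ 2} ⊆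
      Set.Ioo (0 : ℝ) 1 • ((↑) '' ball x s) := by
    rintro z ⟨⟨h1, h2⟩, h3⟩
    set t := inner ℝ (x : EuclideanSpace ℝ (Fin (m + 1))) z with ht
    have hz0 : z ≠ 0 := by rintro rfl; simp [ht] at h1
    have hzn : 0 < ‖z‖ := norm_pos_iff.2 hz0
    have h4 : 1 + (k / h) ^ 2 = (1 / h) ^ 2 := by
      field_simp; linarith
    rw [h4, ← mul_pow] at h3
    have h5 : ‖z‖ < 1 / h * t := lt_of_pow_lt_pow_left₀ 2 (by positivity) h3
    have h6 : h * ‖z‖ < t := by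
      rw [one_div_mul_eq_div, lt_div_iff₀ hh] at h5
      linarith
    have h7 : ‖z‖ < 1 := by nlinarith
    have hw : ‖‖z‖⁻¹ • z‖ = 1 := by
      rw [norm_smul, norm_inv, norm_norm, inv_mul_cancel₀ hzn.ne']
    refine ⟨‖z‖, ⟨hzn, h7⟩, ‖z‖⁻¹ • z, ⟨⟨‖z‖⁻¹ • z, by simpa using hw⟩, ?_, rfl⟩, ?_⟩
    · rw [mem_ball, Subtype.dist_eq, dist_eq_norm]
      refine lt_of_pow_lt_pow_left₀ 2 hs ?_
      show ‖‖z‖⁻¹ • z - x‖ ^ 2 < _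
      rw [norm_sub_sq_real, hw, hx, real_inner_smul_left, real_inner_comm, ← ht, hsh]
      have : h < ‖z‖⁻¹ * t := by rw [inv_mul_eq_div, lt_div_iff₀ hzn]; exact h6
      linarith
    · show ‖z‖ • (‖z‖⁻¹ • z) = z
      rw [smul_smul, mul_inv_cancel₀ hzn.ne', one_smul]
  have h1 := measure_mono (μ := volume) hsub
  rw [volume_flatCone hx (by positivity) hh.le] at h1
  have h2 : ENNReal.ofReal (k ^ m * h * ballVol m) ≤
      (volume : Measure (EuclideanSpace ℝ (Fin (m + 1)))).toSphere (ball x s) := by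
    rw [Measure.toSphere_apply' _ measurableSet_ball]
    refine le_trans (le_of_eq ?_) (mul_le_mul_right h1 _)
    rw [finrank_euclideanSpace_fin, ← ENNReal.ofReal_natCast, ← ENNReal.ofReal_mul (by positivity)]
    congr 1
    push_cast
    rw [div_pow, pow_succ h]
    field_simp
  exact (ENNReal.ofReal_le_iff_le_toReal (measure_ne_top _ _)).1 h2

/-- A lower bound for the measure of the spherical cap of chordal radius `r / 2`. Its base has
radius `k = √(r² / 4 * (1 - r² / 16))` and distance `1 - r² / 8` from the origin. -/
lemma le_uniformSphere_ball {m : ℕ} (hm : 1 ≤ m)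
    (x : sphere (0 : EuclideanSpace ℝ (Fin (m + 1))) 1) {r : ℝ} (hr : 0 < r) (hr1 : r ≤ 1) :
    (r / √6) ^ m * (ballVol m / sphereVol (m + 1)) ≤
      (uniformSphere (m + 1)).real (ball x (r / 2)) := by
  have hb := ballVol_pos m
  have hS := sphereVol_pos m
  have h6 : 0 < √(6 : ℝ) := by positivity
  set h := 1 - r ^ 2 / 8 with hh
  have hh1 : 7 / 8 ≤ h := by nlinarith
  have hr2 : r ^ 2 ≤ 1 := by nlinarith
  have hk2 : 0 < r ^ 2 / 4 * (1 - r ^ 2 / 16) := by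
    have : 0 < r ^ 2 := by positivity
    nlinarith
  have hcap := le_toSphere_ball x (s := r / 2) (h := h) (k := √(r ^ 2 / 4 * (1 - r ^ 2 / 16)))
    (by positivity) (by linarith) (Real.sqrt_pos.2 hk2) (by rw [Real.sq_sqrt hk2.le]; ring)
    (by ring)
  rw [uniformSphere_real_apply, ← mul_div_assoc]
  gcongr
  refine le_trans ?_ hcap
  gcongr
  -- `15 / 64 > (8 / 7)² / 6`: passing from `4` to `6` absorbs the distance `h ≥ 7 / 8`
  have h1 : 8 / 7 * (r / √6) ≤ √(r ^ 2 / 4 * (1 - r ^ 2 / 16)) := by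
    refine Real.le_sqrt_of_sq_le ?_
    rw [mul_pow, div_pow r, Real.sq_sqrt (by norm_num)]
    nlinarith [sq_nonneg r]
  calc (r / √6) ^ m = 8 / 7 * (r / √6) ^ m * (7 / 8) := by ring
    _ ≤ (8 / 7) ^ m * (r / √6) ^ m * (7 / 8) := by
      gcongr
      exact le_self_pow₀ (by norm_num) (by omega)
    _ = (8 / 7 * (r / √6)) ^ m * (7 / 8) := by rw [mul_pow]
    _ ≤ √(r ^ 2 / 4 * (1 - r ^ 2 / 16)) ^ m * h := by gcongr

/-! ### Random points are in general position -/

/-- A proper affine subspace, given as the affine span of few points, meets the sphere in a null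
set. -/
lemma uniformSphere_affineSpan {m k : ℕ} (hm : 1 ≤ m) (hk : k ≤ m)
    (z : Fin (k + 1) → EuclideanSpace ℝ (Fin (m + 1))) :
    uniformSphere (m + 1) {x | (x : EuclideanSpace ℝ (Fin (m + 1))) ∈
      affineSpan ℝ (Set.range z)} = 0 := by
  have hdim : Module.finrank ℝ (vectorSpan ℝ (Set.range z)) ≤ k :=
    finrank_vectorSpan_range_le ℝ z (by simp)
  have hne : (vectorSpan ℝ (Set.range z)) ≠ ⊤ := by
    intro h
    rw [h, finrank_top, finrank_euclideanSpace_fin] at hdim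
    omega
  obtain ⟨v, hv, hv0⟩ := Submodule.exists_mem_ne_zero_of_ne_bot
    (mt (Submodule.orthogonal_eq_bot_iff (K := vectorSpan ℝ (Set.range z))).1 hne)
  have hvn : ‖v‖ ≠ 0 := norm_ne_zero_iff.2 hv0
  refine measure_mono_null ?_ (uniformSphere_hyperplane hm (u := ‖v‖⁻¹ • v)
    (by rw [norm_smul, norm_inv, norm_norm, inv_mul_cancel₀ hvn]) (inner ℝ (‖v‖⁻¹ • v) (z 0)))
  intro x hx
  have h1 : (x : EuclideanSpace ℝ (Fin (m + 1))) - z 0 ∈ vectorSpan ℝ (Set.range z) :=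
    (vsub_mem_vectorSpan_of_mem_affineSpan_of_mem_affineSpan hx
      (mem_affineSpan ℝ ⟨0, rfl⟩) :)
  have h2 := (Submodule.mem_orthogonal' _ _).1 hv _ h1
  show inner ℝ (‖v‖⁻¹ • v) (x : EuclideanSpace ℝ (Fin (m + 1))) = _
  rw [real_inner_smul_left, real_inner_smul_left]
  rw [inner_sub_right] at h2
  rw [sub_eq_zero.1 h2]

lemma isOpen_affineIndependent_sphere (n k : ℕ) :
    IsOpen {x : Fin k → sphere (0 : EuclideanSpace ℝ (Fin n)) 1 |
      AffineIndependent ℝ fun i => (x i : EuclideanSpace ℝ (Fin n))} :=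
  (isOpen_setOfPred_affineIndependent (𝕜 := ℝ) (E := EuclideanSpace ℝ (Fin n)) (ι := Fin k)
    ).preimage
    (by fun_prop : Continuous fun (x : Fin k → sphere (0 : EuclideanSpace ℝ (Fin n)) 1) i =>
      (x i : EuclideanSpace ℝ (Fin n)))

/-- At most `m + 2` independent uniform points on the sphere of `ℝᵐ⁺¹` are almost surely affinely
independent: each new point avoids the affine span of the previous ones. -/
lemma ae_affineIndependent {m : ℕ} (hm : 1 ≤ m) (k : ℕ) (hk : k ≤ m + 1) :
    ∀ᵐ x ∂Measure.pi fun _ : Fin (k + 1) => uniformSphere (m + 1),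
      AffineIndependent ℝ fun i => (x i : EuclideanSpace ℝ (Fin (m + 1))) := by
  have hσ : SigmaFinite (uniformSphere (m + 1)) := inferInstance
  induction k with
  | zero =>
    refine Filter.Eventually.of_forall fun x => ?_
    have : Subsingleton (Fin (0 + 1)) := inferInstanceAs (Subsingleton (Fin 1))
    exact affineIndependent_of_subsingleton ℝ _
  | succ k ih =>
    have hmp := measurePreserving_piFinSuccAbove
      (fun _ : Fin (k + 1 + 1) => uniformSphere (m + 1)) 0
    set e := MeasurableEquiv.piFinSuccAbove
      (fun _ : Fin (k + 1 + 1) => sphere (0 : EuclideanSpace ℝ (Fin (m + 1))) 1) 0 with he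
    set D : Set (Fin (k + 1 + 1) → sphere (0 : EuclideanSpace ℝ (Fin (m + 1))) 1) :=
      {x | ¬ AffineIndependent ℝ fun i => (x i : EuclideanSpace ℝ (Fin (m + 1)))} with hD
    have hDm : MeasurableSet D := (isOpen_affineIndependent_sphere _ _).measurableSet.compl
    show (Measure.pi fun _ : Fin (k + 1 + 1) => uniformSphere (m + 1)) D = 0
    rw [← (hmp.symm e).measure_preimage hDm.nullMeasurableSet,
      Measure.prod_apply_symm (e.symm.measurable hDm)]
    refine lintegral_eq_zero_of_ae_eq_zero ?_
    filter_upwards [ih (by omega)] with z hz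
    refine measure_mono_null ?_ (uniformSphere_affineSpan hm (by omega : k ≤ m)
      fun i => (z i : EuclideanSpace ℝ (Fin (m + 1))))
    intro y hy
    by_contra hys
    have h0 : e.symm (y, z) 0 = y := rfl
    have hsucc : ∀ i : Fin (k + 1), e.symm (y, z) i.succ = z i := fun i => rfl
    refine hy (AffineIndependent.affineIndependent_of_notMem_span (i := 0) ?_ ?_)
    · rw [← affineIndependent_equiv (finSuccAboveEquiv (0 : Fin (k + 1 + 1)))]
      exact hz
    · have himg : (fun i => (e.symm (y, z) i : EuclideanSpace ℝ (Fin (m + 1)))) '' {i | i ≠ 0} =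
          Set.range fun i => (z i : EuclideanSpace ℝ (Fin (m + 1))) := by
        ext w
        simp only [Set.mem_image, Set.mem_ofPred_eq, Set.mem_range]
        rw [Fin.exists_fin_succ]
        simp [hsucc]
      rw [himg]
      exact hys

lemma ae_generalPosition {m : ℕ} (hm : 1 ≤ m) (N : ℕ) :
    ∀ᵐ x ∂Measure.pi fun _ : Fin N => uniformSphere (m + 1),
      GeneralPosition fun i => (x i : EuclideanSpace ℝ (Fin (m + 1))) := by
  refine ae_all_iff.2 fun J => ?_
  have hind : iIndepFun (fun (i : Fin N) (x : Fin N → sphere (0 : EuclideanSpace ℝ (Fin (m + 1))) 1)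
      => x i) (Measure.pi fun _ : Fin N => uniformSphere (m + 1)) :=
    iIndepFun_pi (X := fun _ => id) fun _ => aemeasurable_id
  have hmap := (hind.precomp J.injective).map_fun_eq_pi_map
    fun i => (measurable_pi_apply (J i)).aemeasurable
  have hev : ∀ i, (Measure.pi fun _ : Fin N => uniformSphere (m + 1)).map
      (fun x => x (J i)) = uniformSphere (m + 1) := fun i =>
    (measurePreserving_eval (fun _ : Fin N => uniformSphere (m + 1)) (J i)).map_eq
  simp only [hev] at hmap
  have h := ae_affineIndependent hm (m + 1) le_rfl
  rw [← hmap] at h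
  exact ae_of_ae_map (f := fun (x : Fin N → sphere (0 : EuclideanSpace ℝ (Fin (m + 1))) 1) i =>
    x (J i)) (measurable_pi_lambda _ fun i => measurable_pi_apply (J i)).aemeasurable h

/-! ### Large facets and empty balls -/

/-- The unit normal `u` ranges over a compact set, so that the projection forgetting it is
closed. -/
lemma isClosed_setOf_isSupporting {m N : ℕ} (I : Fin (m + 1) → Fin N) :
    IsClosed {x : Fin N → EuclideanSpace ℝ (Fin (m + 1)) | ∃ u, IsSupporting x I u} := by
  set C : Set (sphere (0 : EuclideanSpace ℝ (Fin (m + 1))) 1 ×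
      (Fin N → EuclideanSpace ℝ (Fin (m + 1)))) :=
    ⋂ i, ⋂ j, {p | inner ℝ (p.1 : EuclideanSpace ℝ (Fin (m + 1))) (p.2 j) ≤
      inner ℝ (p.1 : EuclideanSpace ℝ (Fin (m + 1))) (p.2 (I i))} with hC
  have hCc : IsClosed C := isClosed_iInter fun i => isClosed_iInter fun j =>
    isClosed_le (by fun_prop) (by fun_prop)
  convert isClosedMap_snd_of_compactSpace C hCc using 1
  ext x
  constructor
  · rintro ⟨u, hu, h⟩
    refine ⟨(⟨u, by simpa using hu⟩, x), ?_, rfl⟩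
    exact Set.mem_iInter.2 fun i => Set.mem_iInter.2 fun j => h i j
  · rintro ⟨⟨u, x⟩, h, rfl⟩
    refine ⟨u, norm_eq_of_mem_sphere u, fun i j => ?_⟩
    exact Set.mem_iInter.1 (Set.mem_iInter.1 h i) j

lemma measurable_supportingVol {m N : ℕ} (I : Fin (m + 1) → Fin N) :
    Measurable (supportingVol (m := m) I) := by
  refine Measurable.indicator ?_ (isClosed_setOf_isSupporting I).measurableSet
  have hG : Continuous fun x : Fin N → EuclideanSpace ℝ (Fin (m + 1)) => edgeGram (x ∘ I) := by
    refine continuous_matrix fun i j => ?_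
    simp only [edgeGram, Matrix.of_apply, Function.comp_apply]
    fun_prop
  exact (hG.matrix_det.sqrt.mul continuous_const).measurable

/-- If every ball of radius `r / 2` has probability at least `a`, then `N` independent points leave
some ball of radius `r` empty with probability at most `(1 - a) ^ N / a`. Such an empty ball
contains the empty ball of radius `r / 2` about each point `y` in a set of probability at least `a`;
integrate over `y`. -/
lemma mul_pi_exists_empty_ball_le {X : Type*} [PseudoMetricSpace X] [SecondCountableTopology X]
    [MeasurableSpace X] [BorelSpace X] (σ : Measure X) [IsProbabilityMeasure σ] (N : ℕ) {a r : ℝ}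
    (ha : ∀ y, a ≤ σ.real (ball y (r / 2))) :
    ENNReal.ofReal a * Measure.pi (fun _ : Fin N => σ) {x | ∃ u, ∀ j, r ≤ dist (x j) u} ≤
      ENNReal.ofReal ((1 - a) ^ N) := by
  set ν := Measure.pi (fun _ : Fin N => σ) with hν
  set B : Set ((Fin N → X) × X) := ⋂ j, {p | r / 2 ≤ dist (p.1 j) p.2} with hB
  have hBm : MeasurableSet B := by
    refine (isClosed_iInter fun j => isClosed_le (by fun_prop) (by fun_prop)).measurableSet
  have hcompl : ∀ y, σ (ball y (r / 2))ᶜ ≤ ENNReal.ofReal (1 - a) := fun y => by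
    rw [← ENNReal.ofReal_toReal (measure_ne_top σ (ball y (r / 2))ᶜ)]
    refine ENNReal.ofReal_le_ofReal ?_
    have := ha y
    change σ.real _ ≤ _
    rw [probReal_compl_eq_one_sub measurableSet_ball]
    linarith
  have h1 : (ν.prod σ) B ≤ ENNReal.ofReal ((1 - a) ^ N) := by
    rw [Measure.prod_apply_symm hBm]
    calc ∫⁻ y, ν ((fun x => (x, y)) ⁻¹' B) ∂σ ≤ ∫⁻ _, ENNReal.ofReal ((1 - a) ^ N) ∂σ := by
          refine lintegral_mono fun y => ?_
          have : (fun x : Fin N → X => (x, y)) ⁻¹' B =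
              Set.pi Set.univ fun _ => (ball y (r / 2))ᶜ := by
            ext x
            simp [hB]
          rw [this, hν, Measure.pi_pi, Finset.prod_const, Finset.card_univ, Fintype.card_fin]
          rcases le_or_gt a 1 with h | h
          · rw [ENNReal.ofReal_pow (by linarith)]
            exact pow_le_pow_left' (hcompl y) N
          · exact absurd ((ha y).trans measureReal_le_one) (not_le.2 h)
      _ = _ := by simp
  have h2 : {x : Fin N → X | ∃ u, ∀ j, r ≤ dist (x j) u} ⊆
      {x | ENNReal.ofReal a ≤ σ (Prod.mk x ⁻¹' B)} := by
    rintro x ⟨u, hu⟩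
    have hsub : ball u (r / 2) ⊆ Prod.mk x ⁻¹' B := by
      intro y hy
      simp only [hB, Set.mem_preimage, Set.mem_iInter, Set.mem_ofPred_eq]
      intro j
      have := dist_triangle (x j) y u
      have := hu j
      rw [mem_ball] at hy
      linarith
    refine le_trans ?_ (measure_mono hsub)
    exact ENNReal.ofReal_le_of_le_toReal (ha u)
  calc ENNReal.ofReal a * ν {x | ∃ u, ∀ j, r ≤ dist (x j) u}
      ≤ ENNReal.ofReal a * ν {x | ENNReal.ofReal a ≤ σ (Prod.mk x ⁻¹' B)} := by gcongr
    _ ≤ ∫⁻ x, σ (Prod.mk x ⁻¹' B) ∂ν :=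
        mul_meas_ge_le_lintegral (measurable_measure_prodMk_left hBm) _
    _ = (ν.prod σ) B := (Measure.prod_apply hBm).symm
    _ ≤ _ := h1

/-- A large supporting simplex forces a large empty ball on the sphere, centred at the outer unit
normal `u`. Its radius `ρ` is the circumradius of the section of the sphere by the supporting
hyperplane. -/
lemma IsSupporting.exists_le_dist {m N : ℕ} (hm : 1 ≤ m)
    {x : Fin N → sphere (0 : EuclideanSpace ℝ (Fin (m + 1))) 1} {I : Fin (m + 1) → Fin N}
    {u : EuclideanSpace ℝ (Fin (m + 1))}
    (h : IsSupporting (fun i => (x i : EuclideanSpace ℝ (Fin (m + 1)))) I u) :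
    ∃ ρ : ℝ, 0 ≤ ρ ∧ ρ ≤ 1 ∧
      supportingVol I (fun i => (x i : EuclideanSpace ℝ (Fin (m + 1)))) ≤
        ρ ^ m * regularSimplexVol m ∧
      ∃ y : sphere (0 : EuclideanSpace ℝ (Fin (m + 1))) 1, ∀ j, ρ ≤ dist (x j) y := by
  set c := inner ℝ u (x (I 0) : EuclideanSpace ℝ (Fin (m + 1))) with hc
  refine ⟨√(1 - c ^ 2), Real.sqrt_nonneg _, Real.sqrt_le_one.2 (by nlinarith [sq_nonneg c]), ?_,
    ⟨u, by simpa using h.1⟩, fun j => ?_⟩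
  · rw [h.supportingVol_eq]
    exact simplexVol_le hm h.1 _ h.inner_eq fun i => norm_eq_of_mem_sphere _
  · refine Real.sqrt_le_iff.2 ⟨dist_nonneg, ?_⟩
    have hj : inner ℝ u (x j : EuclideanSpace ℝ (Fin (m + 1))) ≤ c := h.2 0 j
    rw [Subtype.dist_eq, dist_eq_norm]
    show 1 - c ^ 2 ≤ ‖(x j : EuclideanSpace ℝ (Fin (m + 1))) - u‖ ^ 2
    have hxj : ‖(x j : EuclideanSpace ℝ (Fin (m + 1)))‖ = 1 := norm_eq_of_mem_sphere (x j)
    have hu : ‖u‖ = 1 := h.1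
    rw [norm_sub_sq_real, hxj, hu, real_inner_comm]
    nlinarith [sq_nonneg (1 - c)]

/-- The constant `c` such that a facet of volume `t` forces empty caps of probability at least
`c * t`. -/
noncomputable def capConst (m : ℕ) : ℝ :=
  ballVol m / (sphereVol (m + 1) * (regularSimplexVol m * √6 ^ m))

lemma capConst_pos {m : ℕ} (hm : 1 ≤ m) : 0 < capConst m := by
  have := ballVol_pos m
  have := sphereVol_pos m
  have := regularSimplexVol_pos hm
  rw [capConst]
  positivity

/-- The tail bound for the largest volume of a supporting simplex. -/
lemma pi_le_iSup_supportingVol {m N : ℕ} (hm : 1 ≤ m) (hN : 1 ≤ N) {t : ℝ} (ht : 0 < t) :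
    (Measure.pi fun _ : Fin N => uniformSphere (m + 1)).real
      {x | t ≤ ⨆ I : Fin (m + 1) → Fin N,
        supportingVol I fun i => (x i : EuclideanSpace ℝ (Fin (m + 1)))} ≤
      min 1 (1 / (capConst m * t) * max 0 (1 - capConst m * t) ^ N) := by
  have hc := capConst_pos hm
  have hV := regularSimplexVol_pos hm
  have hm0 : m ≠ 0 := by omega
  have : Nonempty (Fin N) := ⟨⟨0, hN⟩⟩
  refine le_min measureReal_le_one ?_
  have key : ∀ x : Fin N → sphere (0 : EuclideanSpace ℝ (Fin (m + 1))) 1,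
      (t ≤ ⨆ I : Fin (m + 1) → Fin N,
        supportingVol I fun i => (x i : EuclideanSpace ℝ (Fin (m + 1)))) →
      ∃ ρ : ℝ, 0 ≤ ρ ∧ ρ ≤ 1 ∧ t / regularSimplexVol m ≤ ρ ^ m ∧
      ∃ y : sphere (0 : EuclideanSpace ℝ (Fin (m + 1))) 1, ∀ j, ρ ≤ dist (x j) y := by
    intro x hx
    obtain ⟨I, hI⟩ := exists_eq_ciSup_of_finite
      (f := fun I : Fin (m + 1) → Fin N =>
        supportingVol I fun i => (x i : EuclideanSpace ℝ (Fin (m + 1))))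
    rw [← hI] at hx
    by_cases hs : ∃ u, IsSupporting (fun i => (x i : EuclideanSpace ℝ (Fin (m + 1)))) I u
    · obtain ⟨u, hu⟩ := hs
      obtain ⟨ρ, h0, h1, h2, h3⟩ := hu.exists_le_dist hm
      exact ⟨ρ, h0, h1, (div_le_iff₀ hV).2 (hx.trans h2), h3⟩
    · rw [supportingVol, Set.indicator_of_notMem (show _ ∉ {x | ∃ u, IsSupporting x I u} from hs)]
        at hx
      exact absurd hx (not_le.2 ht)
  -- no facet is larger than the regular simplex inscribed in the unit sphere
  rcases le_or_gt (t / regularSimplexVol m) 1 with h1 | h1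
  · set r := (t / regularSimplexVol m) ^ (1 / (m : ℝ)) with hr
    have htV : 0 < t / regularSimplexVol m := div_pos ht hV
    have hr0 : 0 < r := Real.rpow_pos_of_pos htV _
    have hrm : r ^ m = t / regularSimplexVol m := by
      rw [hr, one_div, Real.rpow_inv_natCast_pow htV.le hm0]
    have hr1 : r ≤ 1 := by
      rw [← one_pow m, ← hrm] at h1
      exact le_of_pow_le_pow_left₀ hm0 zero_le_one h1
    have ha : (r / √6) ^ m * (ballVol m / sphereVol (m + 1)) = capConst m * t := by
      have := sphereVol_pos m
      rw [div_pow, hrm, capConst]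
      field_simp
    have hcap : ∀ y, capConst m * t ≤ (uniformSphere (m + 1)).real (ball y (r / 2)) := fun y =>
      ha ▸ le_uniformSphere_ball hm y hr0 hr1
    have hle := mul_pi_exists_empty_ball_le (uniformSphere (m + 1)) N hcap
    have h2 : capConst m * t ≤ 1 :=
      (hcap ⟨EuclideanSpace.single 0 1, by simp⟩).trans measureReal_le_one
    have hsub : {x : Fin N → sphere (0 : EuclideanSpace ℝ (Fin (m + 1))) 1 |
        t ≤ ⨆ I : Fin (m + 1) → Fin N,
          supportingVol I fun i => (x i : EuclideanSpace ℝ (Fin (m + 1)))} ⊆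
        {x | ∃ u, ∀ j, r ≤ dist (x j) u} := by
      intro x hx
      obtain ⟨ρ, h0, -, h3, y, hy⟩ := key x hx
      refine ⟨y, fun j => le_trans ?_ (hy j)⟩
      rw [← hrm] at h3
      exact le_of_pow_le_pow_left₀ hm0 h0 h3
    have h3 := ENNReal.toReal_mono ENNReal.ofReal_ne_top hle
    rw [ENNReal.toReal_mul, ENNReal.toReal_ofReal (by positivity),
      ENNReal.toReal_ofReal (pow_nonneg (by linarith) N)] at h3
    rw [max_eq_right (by linarith), one_div, inv_mul_eq_div, le_div_iff₀' (by positivity)]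
    refine le_trans ?_ h3
    gcongr
    exact measureReal_mono hsub
  · have hempty : {x : Fin N → sphere (0 : EuclideanSpace ℝ (Fin (m + 1))) 1 |
        t ≤ ⨆ I : Fin (m + 1) → Fin N,
          supportingVol I fun i => (x i : EuclideanSpace ℝ (Fin (m + 1)))} = ∅ := by
      refine Set.eq_empty_of_forall_notMem fun x hx => ?_
      obtain ⟨ρ, h0, h2, h3, -⟩ := key x hx
      exact absurd (h3.trans (pow_le_one₀ h0 h2)) (not_le.2 h1)
    rw [hempty, measureReal_empty]
    positivity

/-! ### Integration of the tail bound -/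

/-- Integration of the tail bound, split at the level `log N / N`. -/
lemma integral_le_of_tail_le {Ω : Type*} [MeasurableSpace Ω] {μ : Measure Ω}
    {Y : Ω → ℝ} (hY : Integrable Y μ) (hY0 : ∀ ω, 0 ≤ Y ω) {N : ℕ} (hN : 3 ≤ N)
    (htail : ∀ a, 0 < a → μ.real {ω | a ≤ Y ω} ≤ min 1 (1 / a * max 0 (1 - a) ^ N)) :
    ∫ ω, Y ω ∂μ ≤ √6 * (Real.log N / N) := by
  have hN3 : (3 : ℝ) ≤ N := by exact_mod_cast hN
  have hN0 : (0 : ℝ) < N := by linarith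
  have hL1 : 1 ≤ Real.log N := by
    rw [Real.le_log_iff_exp_le hN0]
    linarith [Real.exp_one_lt_d9]
  set δ := Real.log N / N with hδ
  have hδ0 : 0 < δ := by positivity
  have hδ1 : δ ≤ 1 := by
    rw [hδ, div_le_one hN0]
    linarith [Real.log_le_sub_one_of_pos hN0]
  set H : ℝ → ℝ := (Set.Ioc 0 δ).indicator (fun _ => 1) +
    (Set.Ioc δ 1).indicator (fun t => 1 / δ * (1 - t) ^ N) with hH
  have hi1 : Integrable ((Set.Ioc 0 δ).indicator fun _ => (1 : ℝ)) :=
    (integrable_indicator_iff measurableSet_Ioc).2 (integrableOn_const (by simp))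
  have hi2 : Integrable ((Set.Ioc δ 1).indicator fun t => 1 / δ * (1 - t) ^ N) :=
    (integrable_indicator_iff measurableSet_Ioc).2
      ((by fun_prop : Continuous fun t : ℝ => 1 / δ * (1 - t) ^ N
        ).continuousOn.integrableOn_Icc.mono_set Set.Ioc_subset_Icc_self)
  have hint : ∫ t in Set.Ioi (0 : ℝ), H t = δ + 1 / δ * ((1 - δ) ^ (N + 1) / (N + 1)) := by
    rw [hH, integral_add' hi1.integrableOn hi2.integrableOn,
      setIntegral_indicator measurableSet_Ioc, setIntegral_indicator measurableSet_Ioc,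
      Set.inter_eq_right.2 (Set.Ioc_subset_Ioi_self : Set.Ioc 0 δ ⊆ Set.Ioi 0),
      Set.inter_eq_right.2 ((Set.Ioc_subset_Ioi_self : Set.Ioc δ 1 ⊆ Set.Ioi δ).trans
        (Set.Ioi_subset_Ioi hδ0.le))]
    congr 1
    · simp [hδ0.le]
    · rw [← intervalIntegral.integral_of_le hδ1, intervalIntegral.integral_const_mul,
        intervalIntegral.integral_comp_sub_left (fun t => t ^ N) 1]
      simp [integral_pow]
  have hle : ∫ ω, Y ω ∂μ ≤ ∫ t in Set.Ioi (0 : ℝ), H t := by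
    rw [hY.integral_eq_integral_meas_le (Filter.Eventually.of_forall hY0)]
    refine integral_mono_of_nonneg (Filter.Eventually.of_forall fun t => measureReal_nonneg)
      (hi1.add hi2).integrableOn ?_
    filter_upwards [ae_restrict_mem measurableSet_Ioi] with t ht
    have ht0 : 0 < t := ht
    have h := htail t ht
    simp only [hH, Pi.add_apply]
    rcases le_or_gt t δ with h1 | h1
    · rw [Set.indicator_of_mem (Set.mem_Ioc.2 ⟨ht0, h1⟩),
        Set.indicator_of_notMem fun h2 => not_lt.2 h1 h2.1, add_zero]
      exact h.trans (min_le_left _ _)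
    · rw [Set.indicator_of_notMem fun h2 => not_lt.2 h2.2 h1, zero_add]
      refine (h.trans (min_le_right _ _)).trans ?_
      rcases le_or_gt t 1 with h2 | h2
      · rw [Set.indicator_of_mem (Set.mem_Ioc.2 ⟨h1, h2⟩), max_eq_right (by linarith)]
        have : 0 ≤ 1 - t := by linarith
        gcongr
      · rw [Set.indicator_of_notMem fun h3 => not_lt.2 h3.2 h2, max_eq_left (by linarith),
          zero_pow (by omega), mul_zero]
  have hpow : (1 - δ) ^ (N + 1) ≤ 1 / N := by
    calc (1 - δ) ^ (N + 1) ≤ (1 - δ) ^ N :=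
          pow_le_pow_of_le_one (by linarith) (by linarith) (Nat.le_succ N)
      _ ≤ Real.exp (-δ) ^ N := by
          exact pow_le_pow_left₀ (by linarith) (Real.one_sub_le_exp_neg δ) N
      _ = 1 / N := by
          rw [← Real.exp_nat_mul, hδ, mul_neg, mul_div_cancel₀ _ hN0.ne', Real.exp_neg,
            Real.exp_log hN0, one_div]
  have hsecond : 1 / δ * ((1 - δ) ^ (N + 1) / (N + 1)) ≤ δ := by
    calc 1 / δ * ((1 - δ) ^ (N + 1) / (N + 1)) ≤ 1 / δ * ((1 / N) / N) := by
          gcongr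
          linarith
      _ ≤ δ := by
          rw [one_div_mul_eq_div, div_le_iff₀ hδ0, hδ, div_mul_div_comm, div_div]
          gcongr
          nlinarith
  have h6 : 2 ≤ √(6 : ℝ) := Real.le_sqrt_of_sq_le (by norm_num)
  calc ∫ ω, Y ω ∂μ ≤ δ + δ := by linarith
    _ ≤ √6 * δ := by nlinarith

lemma rpow_natCast_div_two {x : ℝ} (hx : 0 ≤ x) (k : ℕ) : x ^ ((k : ℝ) / 2) = √x ^ k := by
  rw [Real.sqrt_eq_rpow, ← Real.rpow_natCast, ← Real.rpow_mul hx]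
  congr 1
  ring

lemma inv_capConst (m : ℕ) : 1 / capConst m =
    √(m + 1) / m ! * (√6 * √((m + 1) / m)) ^ m * (sphereVol (m + 1) / ballVol m) := by
  rw [capConst, regularSimplexVol, one_div_div, mul_pow]
  ring

/-- The factor `√((m + 1) / m) ^ m` of `1 / capConst m` is at most `√e`. -/
lemma inv_capConst_mul_le {m : ℕ} (hm : 1 ≤ m) {L : ℝ} (hL : 0 ≤ L) :
    1 / capConst m * (√6 * L) ≤ (6 : ℝ) ^ (((m + 1 : ℕ) : ℝ) / 2) *
      (√(Real.exp 1 * (m + 1)) / m !) * (sphereVol (m + 1) / ballVol m) * L := by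
  have hm0 : (0 : ℝ) < m := by exact_mod_cast hm
  have hb := ballVol_pos m
  have hS := sphereVol_pos m
  have he : √(((m : ℝ) + 1) / m) ^ m ≤ √(Real.exp 1) := by
    refine Real.le_sqrt_of_sq_le ?_
    rw [← pow_mul, mul_comm, pow_mul, Real.sq_sqrt (by positivity)]
    calc (((m : ℝ) + 1) / m) ^ m ≤ Real.exp (1 / m) ^ m := by
          gcongr
          rw [add_div, div_self hm0.ne', add_comm]
          linarith [Real.add_one_le_exp (1 / (m : ℝ))]
      _ = Real.exp 1 := by
          rw [← Real.exp_nat_mul, mul_one_div_cancel hm0.ne']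
  rw [inv_capConst m, rpow_natCast_div_two (by norm_num), Real.sqrt_mul (Real.exp_pos 1).le]
  calc _ = √6 ^ (m + 1) * (√((m + 1) / m) ^ m * √(m + 1) / m !) *
        (sphereVol (m + 1) / ballVol m) * L := by ring
    _ ≤ _ := by gcongr

/-! ### The random polytope -/

lemma ae_maxFacetVol_eq {m N : ℕ} (hm : 1 ≤ m) (hN : m + 2 ≤ N) :
    (fun x => maxFacetVol (spherePolytope x)) =ᵐ[Measure.pi fun _ : Fin N => uniformSphere (m + 1)]
      fun x => ⨆ I : Fin (m + 1) → Fin N,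
        supportingVol I fun i => (x i : EuclideanSpace ℝ (Fin (m + 1))) := by
  filter_upwards [ae_generalPosition hm N] with x hx
  exact hx.maxFacetVol_eq hN

lemma iSup_supportingVol_le {m N : ℕ} (hm : 1 ≤ m)
    (x : Fin N → sphere (0 : EuclideanSpace ℝ (Fin (m + 1))) 1) :
    ⨆ I : Fin (m + 1) → Fin N, supportingVol I (fun i => (x i : EuclideanSpace ℝ (Fin (m + 1)))) ≤
      regularSimplexVol m := by
  have hV := (regularSimplexVol_pos hm).le
  refine Real.iSup_le (fun I => ?_) hV
  by_cases hs : ∃ u, IsSupporting (fun i => (x i : EuclideanSpace ℝ (Fin (m + 1)))) I u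
  · obtain ⟨u, hu⟩ := hs
    obtain ⟨ρ, h0, h1, h2, -⟩ := hu.exists_le_dist hm
    exact h2.trans (mul_le_of_le_one_left hV (pow_le_one₀ h0 h1))
  · rw [supportingVol, Set.indicator_of_notMem (show _ ∉ {x | ∃ u, IsSupporting x I u} from hs)]
    exact hV

end

theorem theorem10 {Ω : Type*} [MeasurableSpace Ω] (μ : Measure Ω) [IsProbabilityMeasure μ]
    (n N : ℕ) (hn : 2 ≤ n) (hN : 1 ≤ N)
    (ξ : Fin N → Ω → sphere (0 : EuclideanSpace ℝ (Fin n)) 1)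
    (hlaw : ∀ i, HasLaw (ξ i) (uniformSphere n) μ) (hindep : iIndepFun ξ μ) :
    (∀ t : ℝ, 0 < t →
      μ.real {ω | t ≤ maxFacetVol (spherePolytope fun i => ξ i ω)} ≤
        min 1
          (Real.sqrt n / (t * (n - 1)!) * (6 * n / (n - 1) : ℝ) ^ (((n : ℝ) - 1) / 2) *
              (sphereVol n / ballVol (n - 1)) *
            (max 0
              (1 - t * ((n - 1)! / Real.sqrt n) * ((n - 1) / (6 * n) : ℝ) ^ (((n : ℝ) - 1) / 2) *
                (ballVol (n - 1) / sphereVol n))) ^ N)) ∧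
    Integrable (fun ω => maxFacetVol (spherePolytope fun i => ξ i ω)) μ ∧
    ∫ ω, maxFacetVol (spherePolytope fun i => ξ i ω) ∂μ ≤
      (6 : ℝ) ^ ((n : ℝ) / 2) * (Real.sqrt (Real.exp 1 * n) / (n - 1)!) *
        (sphereVol n / ballVol (n - 1)) * (Real.log N / N) := by
  obtain ⟨m, rfl⟩ : ∃ m, n = m + 1 := ⟨n - 1, by omega⟩
  have hm : 1 ≤ m := by omega
  have hm0 : (0 : ℝ) < m := by exact_mod_cast hm
  have hb := ballVol_pos m
  have hS := sphereVol_pos m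
  have hc := capConst_pos hm
  -- the constants of the statement in terms of `capConst`
  have hbase : √(6 * ((m : ℝ) + 1) / m) = √6 * √((m + 1) / m) := by
    rw [mul_div_assoc, Real.sqrt_mul (by norm_num)]
  have hinv : ((m : ℝ) / (6 * (m + 1))) ^ ((m : ℝ) / 2) =
      ((√6 * √(((m : ℝ) + 1) / m)) ^ m)⁻¹ := by
    rw [rpow_natCast_div_two (by positivity), ← inv_div, Real.sqrt_inv, hbase, inv_pow]
  have hrhs : ∀ t : ℝ, 0 < t →
      1 / (capConst m * t) * max 0 (1 - capConst m * t) ^ N =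
      √((m + 1 : ℕ) : ℝ) / (t * (m + 1 - 1)!) *
          (6 * (m + 1 : ℕ) / ((m + 1 : ℕ) - 1) : ℝ) ^ ((((m + 1 : ℕ) : ℝ) - 1) / 2) *
          (sphereVol (m + 1) / ballVol (m + 1 - 1)) *
        (max 0 (1 - t * ((m + 1 - 1)! / √((m + 1 : ℕ) : ℝ)) *
          (((m + 1 : ℕ) - 1) / (6 * (m + 1 : ℕ)) : ℝ) ^ ((((m + 1 : ℕ) : ℝ) - 1) / 2) *
            (ballVol (m + 1 - 1) / sphereVol (m + 1)))) ^ N := by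
    intro t ht
    have hci := inv_capConst m
    simp only [Nat.add_sub_cancel, Nat.cast_add, Nat.cast_one, add_sub_cancel_right]
    rw [hinv, rpow_natCast_div_two (by positivity), hbase]
    have h1 : capConst m = (1 / capConst m)⁻¹ := by rw [one_div, inv_inv]
    congr 3
    · rw [← one_div_mul_one_div, hci]
      field_simp
    · congr 1
      rw [h1, hci]
      field_simp
  rcases le_or_gt N (m + 1) with hNm | hNm
  · have h0 : ∀ ω, maxFacetVol (spherePolytope fun i => ξ i ω) = 0 := fun ω =>
      maxFacetVol_eq_zero hNm _
    simp only [h0]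
    refine ⟨fun t ht => ?_, integrable_zero _ _ _, ?_⟩
    · rw [← hrhs t ht]
      have : {ω : Ω | t ≤ 0} = ∅ := Set.eq_empty_of_forall_notMem fun ω h => absurd ht (not_lt.2 h)
      rw [this, measureReal_empty]
      positivity
    · rw [integral_zero]
      have := Real.log_natCast_nonneg N
      have hb' : 0 < ballVol (m + 1 - 1) := hb
      positivity
  set X : Ω → Fin N → sphere (0 : EuclideanSpace ℝ (Fin (m + 1))) 1 := fun ω i => ξ i ω with hX
  have hXm : AEMeasurable X μ := aemeasurable_pi_lambda _ fun i => (hlaw i).aemeasurable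
  have hXlaw : μ.map X = Measure.pi fun _ : Fin N => uniformSphere (m + 1) := by
    rw [hX, hindep.map_fun_eq_pi_map fun i => (hlaw i).aemeasurable]
    simp only [fun i => (hlaw i).map_eq]
  set g : (Fin N → sphere (0 : EuclideanSpace ℝ (Fin (m + 1))) 1) → ℝ := fun x =>
    ⨆ I : Fin (m + 1) → Fin N, supportingVol I fun i => (x i : EuclideanSpace ℝ (Fin (m + 1)))
    with hg
  have hgm : Measurable g := .iSup fun I => (measurable_supportingVol I).comp (by fun_prop)
  have hg0 : ∀ x, 0 ≤ g x := fun x => Real.iSup_nonneg fun I => supportingVol_nonneg I _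
  have hae : (fun ω => maxFacetVol (spherePolytope fun i => ξ i ω)) =ᵐ[μ] fun ω => g (X ω) := by
    have h := ae_maxFacetVol_eq hm hNm
    rw [← hXlaw] at h
    exact ae_of_ae_map hXm h
  have htail : ∀ t, 0 < t → μ.real {ω | t ≤ g (X ω)} ≤
      min 1 (1 / (capConst m * t) * max 0 (1 - capConst m * t) ^ N) := fun t ht => by
    refine le_trans (le_of_eq ?_) (pi_le_iSup_supportingVol hm hN ht)
    rw [← hXlaw, Measure.real, Measure.real, Measure.map_apply_of_aemeasurable hXm
      (measurableSet_le measurable_const hgm)]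
    rfl
  have hint : Integrable (fun ω => g (X ω)) μ := by
    refine Integrable.of_bound (hgm.comp_aemeasurable hXm).aestronglyMeasurable
      (regularSimplexVol m) (Filter.Eventually.of_forall fun ω => ?_)
    rw [Real.norm_eq_abs, abs_of_nonneg (hg0 _)]
    exact iSup_supportingVol_le hm _
  refine ⟨fun t ht => ?_, hint.congr hae.symm, ?_⟩
  · rw [← hrhs t ht]
    refine le_trans (le_of_eq (measureReal_congr ?_)) (htail t ht)
    filter_upwards [hae] with ω hω
    exact congrArg (t ≤ ·) hω
  · rw [integral_congr_ae hae]
    have hscaled := integral_le_of_tail_le (Y := fun ω => capConst m * g (X ω)) (N := N)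
      (hint.const_mul _) (fun ω => mul_nonneg hc.le (hg0 _)) (by omega) fun a ha => by
        have h := htail (a / capConst m) (by positivity)
        rw [mul_div_cancel₀ _ hc.ne'] at h
        convert h using 3
        ext ω
        rw [div_le_iff₀' hc]
    rw [integral_const_mul] at hscaled
    have hLN : 0 ≤ Real.log N / N := by
      have := Real.log_natCast_nonneg N
      positivity
    have hfin := inv_capConst_mul_le hm hLN
    rw [one_div_mul_eq_div] at hfin
    simp only [Nat.add_sub_cancel]
    refine ((le_div_iff₀' hc).2 hscaled).trans (hfin.trans_eq ?_)
    push_cast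
    rfl
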